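/- Let $\mathbb K=\mathbb R$ or $\mathbb C$ and $n\ge 2$; $\mathbb K^{n}$ carries the canonical Hermitian product, $\mathbb K^{n\times n}$ the Frobenius product $\langle A,B\rangle_F=\mathrm{trace}(B^*A)$ and $\mathbb K^{n\times n}\times\mathbb K$ the product structure. For a Hermitian space $\mathbb E$, the projective space $\mathbb P(\mathbb E)$ carries the Riemannian structure in which a tangent vector $w\in x^\perp$ at $x$ has norm $\|w\|_x=\|w\|/\|x\|$; its distance is the angle $d_{\mathbb P}(x,y)=\arccos\frac{|\langle x,y\rangle|}{\|x\|\|y\|}$. On $\mathbb P(\mathbb K^{n\times n}\times\mathbb K)\times\mathbb P(\mathbb K^n)$ take the product structure, with distance $d_{\mathbb P^2}=\big(d_{\mathbb P}^2+d_{\mathbb P}^2\big)^{1/2}$. Let $\mathcal V$ be the solution variety of classes of triples $(A,\lambda,v)$ with $A\neq 0$, $v\ne0$, $(\lambda I_n-A)v=0$, and let $\mathcal W\subset\mathcal V$ be the set of well-posed triples, those at which the derivative of the projection $\mathcal V\to\mathbb P(\mathbb K^{n\times n})$, $(A,\lambda,v)\mapsto A$, is an isomorphism (equivalently, $\lambda$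 is a simple eigenvalue of $A$). For $(A,\lambda,v)\in\mathcal W$ put $$\mu(A,\lambda,v)=\max\big\{1,\ \|A\|_F\,\big\|\big(\Pi_{v^\perp}(\lambda I_n-A)|_{v^\perp}\big)^{-1}\big\|\big\},$$ where $\Pi_{v^\perp}$ is the orthogonal projection onto $v^\perp$ and the second norm is the operator norm. For an absolutely continuous path $\Gamma:[0,1]\to\mathcal W$, that is, the projection of an absolutely continuous path $(A(t),\lambda(t),v(t))$ of nonzero representatives, the condition length is $\ell_\mu(\Gamma)=\int_0^1\|\dot\Gamma(t)\|_{\Gamma(t)}\,\mu(\Gamma(t))\,dt$. For $A\ne0$ let $F_A(\lambda,v)=(\lambda I_n-A)v$ and let $$N_A(\lambda,v)=(\lambda,v)-\big(DF_A(\lambda,v)|_{\mathbb K\times v^\perp}\big)^{-1}F_A(\lambda,v),$$ defined when $v\neq0$ and $DF_A(\lambda,v)|_{\mathbb K\times v^\perp}$ is invertible. The triple $(A,\lambda_0,v_0)$ is an approximate solution of $(A,\lambda,v)\in\mathcal V$ if all iterates $N_A^k(\lambda_0,v_0)$, $k\ge0$, are defined and, for all $k\geq1$, $$d_{\mathbb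 P^2}\big((A,N_A^k(\lambda_0,v_0)),(A,\lambda,v)\big)\le\big(\tfrac12\big)^{2^k-1}d_{\mathbb P^2}\big((A,\lambda_0,v_0),(A,\lambda,v)\big).$$ **Theorem.** Put $C=100$. Let $\Gamma$ be an absolutely continuous path in $\mathcal W$, with absolutely continuous representative $(A(t),\lambda(t),v(t))$, $0\le t\le1$, and with $\ell_\mu(\Gamma)<\infty$. Then there is an absolutely continuous $c:[0,1]\to\mathbb K\setminus\{0\}$ such that $\hat A=cA$ is absolutely continuous with $\|\hat A(t)\|_F=1$ for all $t$ and $\langle\hat A'(t),\hat A(t)\rangle_F=0$ for almost all $t$ (so $\hat A$, $\hat\lambda=c\lambda$, $v$ again represent $\Gamma$), and there are an integer $K$, a mesh $0=t_0<t_1<\dots<t_K=1$ and pairs $(\lambda_k,v_k)\in\mathbb K\times(\mathbb K^n\setminus\{0\})$, $0\le k\le K$, such that 1. for $0\le k<K$, $N_{\hat A(t_{k+1})}$ is defined at $(\lambda_k,v_k)$ and $(\lambda_{k+1},v_{k+1})=N_{\hat A(t_{k+1})}(\lambda_k,v_k)$; 2. for $0\le k\le K$, $(\hat A(t_k),\lambda_k,v_k)$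 is an approximate solution of $\Gamma(t_k)=(\hat A(t_k),\hat\lambda(t_k),v(t_k))$; 3. $K\le C\,\ell_\mu(\Gamma)+1$. In particular there is a universal constant $C$, independent of $n$ and of $\Gamma$, with this property. -/

import Mathlib

open MeasureTheory Set
open scoped ENNReal

noncomputable section

namespace EigenHomotopy

/-! ### The ambient Hermitian spaces -/

/-- The space `𝕜ⁿ` with its canonical Hermitian product. -/
abbrev Vec (𝕜 : Type*) (n : ℕ) : Type _ := EuclideanSpace 𝕜 (Fin n)

/-- The space of `n × n` matrices with the Frobenius Hermitian product; a matrix is stored as the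
family of its entries. -/
abbrev Mat (𝕜 : Type*) (n : ℕ) : Type _ := EuclideanSpace 𝕜 (Fin n × Fin n)

/-- The matrix with the given entries. -/
def Mat.toMatrix {𝕜 : Type*} {n : ℕ} (A : Mat 𝕜 n) : Matrix (Fin n) (Fin n) 𝕜 :=
  Matrix.of fun i j => A (i, j)

/-- The inner product of `Mat 𝕜 n` is the Frobenius product (Mathlib's inner product is conjugate
linear in its first argument). -/
theorem Mat.inner_eq_trace {𝕜 : Type*} [RCLike 𝕜] {n : ℕ} (A B : Mat 𝕜 n) :
    inner 𝕜 B A = (B.toMatrix.conjTranspose * A.toMatrix).trace := by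
  simp only [PiLp.inner_apply, Fintype.sum_prod_type, Matrix.trace, Matrix.diag_apply,
    Matrix.mul_apply, Matrix.conjTranspose_apply, Mat.toMatrix, Matrix.of_apply]
  rw [Finset.sum_comm]
  simp [RCLike.inner_apply, mul_comm]

/-- The space `𝕜^{n×n} × 𝕜` with the product Hermitian structure. -/
abbrev MatScalar (𝕜 : Type*) (n : ℕ) : Type _ := WithLp 2 (Mat 𝕜 n × 𝕜)

/-- The element `(A, l)` of `𝕜^{n×n} × 𝕜`. -/
abbrev pair {𝕜 : Type*} {n : ℕ} (A : Mat 𝕜 n) (l : 𝕜) : MatScalar 𝕜 n := WithLp.toLp 2 (A, l)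

/-- The operator `l Iₙ - A` on `𝕜ⁿ`. -/
def shiftOp {𝕜 : Type*} [RCLike 𝕜] {n : ℕ} (A : Mat 𝕜 n) (l : 𝕜) : Vec 𝕜 n →L[𝕜] Vec 𝕜 n :=
  Matrix.toEuclideanCLM (n := Fin n) (𝕜 := 𝕜) (l • (1 : Matrix (Fin n) (Fin n) 𝕜) - A.toMatrix)

/-! ### Projective metric structures

Points of a projective space are given by nonzero representatives; everything below is invariant
under a change of representatives. -/

/-- The Riemannian distance in `ℙ(E)` between the classes of `x` and `y`: the angle between the
lines that they span. -/
def projDist {𝕜 E : Type*} [RCLike 𝕜] [NormedAddCommGroup E] [InnerProductSpace 𝕜 E]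
    (x y : E) : ℝ :=
  Real.arccos (‖inner 𝕜 x y‖ / (‖x‖ * ‖y‖))

/-- The norm, in the Riemannian structure of `ℙ(E)`, of the tangent vector at the class of `x` which
is the image of `w ∈ E` under the differential of `E ∖ {0} → ℙ(E)`: that tangent vector is
represented by the orthogonal projection of `w` to `xᗮ`, and the norm on `xᗮ` is divided by `‖x‖`. -/
def tangentNorm {𝕜 E : Type*} [RCLike 𝕜] [NormedAddCommGroup E] [InnerProductSpace 𝕜 E]
    (x w : E) : ℝ :=
  ‖(𝕜 ∙ x)ᗮ.starProjection w‖ / ‖x‖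

/-- The Riemannian distance in `ℙ(𝕜^{n×n} × 𝕜) × ℙ(𝕜ⁿ)`. -/
def tripleDist {𝕜 : Type*} [RCLike 𝕜] {n : ℕ} (A : Mat 𝕜 n) (l : 𝕜) (v : Vec 𝕜 n)
    (A' : Mat 𝕜 n) (l' : 𝕜) (v' : Vec 𝕜 n) : ℝ :=
  √(projDist (𝕜 := 𝕜) (pair A l) (pair A' l') ^ 2 + projDist (𝕜 := 𝕜) v v' ^ 2)

/-! ### Well-posed triples and the condition number -/

/-- The tangent space at `(A, l, v)` to the solution variety `{(l I - A) v = 0}` in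
`ℙ(𝕜^{n×n} × 𝕜) × ℙ(𝕜ⁿ)`. -/
def tangentSpace {𝕜 : Type*} [RCLike 𝕜] {n : ℕ} (A : Mat 𝕜 n) (l : 𝕜) (v : Vec 𝕜 n) :
    Submodule 𝕜 (Mat 𝕜 n × 𝕜 × Vec 𝕜 n) where
  carrier := {x | shiftOp x.1 x.2.1 v + shiftOp A l x.2.2 = 0 ∧
    inner 𝕜 (pair A l) (pair x.1 x.2.1) = 0 ∧ inner 𝕜 v x.2.2 = 0}
  add_mem' := by
    rintro ⟨B, b, w⟩ ⟨B', b', w'⟩ ⟨h1, h2, h3⟩ ⟨h1', h2', h3'⟩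
    have hs : shiftOp (B + B') (b + b') = shiftOp B b + shiftOp B' b' := by
      have : (B + B').toMatrix = B.toMatrix + B'.toMatrix := by
        ext i j; simp [Mat.toMatrix]
      rw [shiftOp, shiftOp, shiftOp, this, add_smul, add_sub_add_comm, map_add]
    have hp : pair (B + B') (b + b') = pair B b + pair B' b' := rfl
    refine ⟨?_, ?_, ?_⟩
    · simp only [Prod.mk_add_mk, hs, map_add, add_apply] at h1 h1' ⊢
      rw [add_add_add_comm, h1, h1', add_zero]
    · simp only [Prod.mk_add_mk] at h2 h2' ⊢
      rw [hp, inner_add_right, h2, h2', add_zero]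
    · simp only [Prod.mk_add_mk] at h3 h3' ⊢
      rw [inner_add_right, h3, h3', add_zero]
  zero_mem' := by
    have hs : shiftOp (0 : Mat 𝕜 n) (0 : 𝕜) = 0 := by
      have : (0 : Mat 𝕜 n).toMatrix = 0 := by
        ext i j; simp [Mat.toMatrix]
      simp [shiftOp, this]
    have hp : pair (0 : Mat 𝕜 n) (0 : 𝕜) = 0 := rfl
    refine ⟨?_, ?_, ?_⟩
    · simp [hs]
    · simp only [Prod.fst_zero, Prod.snd_zero, hp, inner_zero_right]
    · simp
  smul_mem' := by
    rintro c ⟨B, b, w⟩ ⟨h1, h2, h3⟩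
    have hs : shiftOp (c • B) (c • b) = c • shiftOp B b := by
      have : (c • B).toMatrix = c • B.toMatrix := by
        ext i j; simp [Mat.toMatrix]
      rw [shiftOp, shiftOp, this, smul_assoc, ← smul_sub, map_smul]
    have hp : pair (c • B) (c • b) = c • pair B b := rfl
    refine ⟨?_, ?_, ?_⟩
    · simp only [Prod.smul_mk, hs, map_smul, smul_apply] at h1 ⊢
      rw [← smul_add, h1, smul_zero]
    · simp only [Prod.smul_mk] at h2 ⊢
      rw [hp, inner_smul_right, h2, mul_zero]
    · simp only [Prod.smul_mk] at h3 ⊢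
      rw [inner_smul_right, h3, mul_zero]

/-- The derivative at `(A, l, v)` of the projection `(A, l, v) ↦ A` of the solution variety to
`ℙ(𝕜^{n×n})`, whose tangent space at `A` is `Aᗮ`. -/
def inputDeriv {𝕜 : Type*} [RCLike 𝕜] {n : ℕ} (A : Mat 𝕜 n) (l : 𝕜) (v : Vec 𝕜 n) :
    tangentSpace A l v →ₗ[𝕜] (𝕜 ∙ A)ᗮ :=
  ((𝕜 ∙ A)ᗮ.orthogonalProjectionOnto : Mat 𝕜 n →ₗ[𝕜] (𝕜 ∙ A)ᗮ) ∘ₗ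
    LinearMap.fst 𝕜 (Mat 𝕜 n) (𝕜 × Vec 𝕜 n) ∘ₗ (tangentSpace A l v).subtype

/-- `(A, l, v)` represents a well-posed triple: it is a point of the solution variety at which the
derivative of the projection to the space of matrices is an isomorphism. -/
def IsWellPosed {𝕜 : Type*} [RCLike 𝕜] {n : ℕ} (A : Mat 𝕜 n) (l : 𝕜) (v : Vec 𝕜 n) : Prop :=
  A ≠ 0 ∧ v ≠ 0 ∧ shiftOp A l v = 0 ∧ Function.Bijective (inputDeriv A l v)

/-- The operator `Π_{vᗮ} (l I - A)|_{vᗮ}` of `vᗮ`. -/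
def compression {𝕜 : Type*} [RCLike 𝕜] {n : ℕ} (A : Mat 𝕜 n) (l : 𝕜) (v : Vec 𝕜 n) :
    (𝕜 ∙ v)ᗮ →L[𝕜] (𝕜 ∙ v)ᗮ :=
  (𝕜 ∙ v)ᗮ.orthogonalProjectionOnto ∘L shiftOp A l ∘L (𝕜 ∙ v)ᗮ.subtypeL

/-- The condition number of a well-posed triple. -/
def condNumber {𝕜 : Type*} [RCLike 𝕜] {n : ℕ} (A : Mat 𝕜 n) (l : 𝕜) (v : Vec 𝕜 n) : ℝ :=
  max 1 (‖A‖ * ‖(compression A l v).inverse‖)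

/-! ### Absolutely continuous paths and the condition length -/

/-- `f` is an absolutely continuous path on `[0, 1]`. -/
def IsAbsCont {E : Type*} [NormedAddCommGroup E] [NormedSpace ℝ E] (f : ℝ → E) : Prop :=
  (∀ᵐ t ∂(volume.restrict (Icc (0 : ℝ) 1)), DifferentiableAt ℝ f t) ∧
  IntegrableOn (deriv f) (Icc (0 : ℝ) 1) ∧
  ∀ t ∈ Icc (0 : ℝ) 1, f t = f 0 + ∫ s in (0 : ℝ)..t, deriv f s

/-- `Γ(t) = (A(t), l(t), v(t))`, `0 ≤ t ≤ 1`, is (an absolutely continuous representative of) an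
absolutely continuous path of well-posed triples. -/
structure IsWellPosedPath {𝕜 : Type*} [RCLike 𝕜] {n : ℕ} (A : ℝ → Mat 𝕜 n) (l : ℝ → 𝕜)
    (v : ℝ → Vec 𝕜 n) : Prop where
  absCont_A : IsAbsCont A
  absCont_l : IsAbsCont l
  absCont_v : IsAbsCont v
  wellPosed : ∀ t ∈ Icc (0 : ℝ) 1, IsWellPosed (A t) (l t) (v t)

/-- The norm of the derivative at time `t` of the path `Γ` in
`ℙ(𝕜^{n×n} × 𝕜) × ℙ(𝕜ⁿ)`. -/
def speed {𝕜 : Type*} [RCLike 𝕜] {n : ℕ} (A : ℝ → Mat 𝕜 n) (l : ℝ → 𝕜) (v : ℝ → Vec 𝕜 n)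
    (t : ℝ) : ℝ :=
  √(tangentNorm (𝕜 := 𝕜) (pair (A t) (l t)) (deriv (fun s => pair (A s) (l s)) t) ^ 2 +
    tangentNorm (𝕜 := 𝕜) (v t) (deriv v t) ^ 2)

/-- The condition length of a path. -/
def condLength {𝕜 : Type*} [RCLike 𝕜] {n : ℕ} (A : ℝ → Mat 𝕜 n) (l : ℝ → 𝕜) (v : ℝ → Vec 𝕜 n) :
    ℝ≥0∞ :=
  ∫⁻ t in Icc (0 : ℝ) 1, ENNReal.ofReal (speed A l v t * condNumber (A t) (l t) (v t))

/-! ### Newton's method -/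

/-- The evaluation map `F_A(l, v) = (l I - A) v`. -/
def evalMap {𝕜 : Type*} [RCLike 𝕜] {n : ℕ} (A : Mat 𝕜 n) (x : 𝕜 × Vec 𝕜 n) : Vec 𝕜 n :=
  shiftOp A x.1 x.2

/-- The restriction of `DF_A(l, v)` to `𝕜 × vᗮ`. -/
def newtonDeriv {𝕜 : Type*} [RCLike 𝕜] {n : ℕ} (A : Mat 𝕜 n) (x : 𝕜 × Vec 𝕜 n) :
    (𝕜 × (𝕜 ∙ x.2)ᗮ) →L[𝕜] Vec 𝕜 n :=
  fderiv 𝕜 (evalMap A) x ∘L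
    (ContinuousLinearMap.id 𝕜 𝕜).prodMap (𝕜 ∙ x.2)ᗮ.subtypeL

/-- The Newton map `N_A` is defined at `x = (l, v)`. -/
def NewtonDefined {𝕜 : Type*} [RCLike 𝕜] {n : ℕ} (A : Mat 𝕜 n) (x : 𝕜 × Vec 𝕜 n) : Prop :=
  x.2 ≠ 0 ∧ (newtonDeriv A x).IsInvertible

/-- The Newton map `N_A(x) = x - (DF_A(x)|_{𝕜 × vᗮ})⁻¹ F_A(x)`, `x = (l, v)`; meaningful where
`NewtonDefined A x` holds. -/
def newtonMap {𝕜 : Type*} [RCLike 𝕜] {n : ℕ} (A : Mat 𝕜 n) (x : 𝕜 × Vec 𝕜 n) : 𝕜 × Vec 𝕜 n :=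
  x - (ContinuousLinearMap.id 𝕜 𝕜).prodMap (𝕜 ∙ x.2)ᗮ.subtypeL
    ((newtonDeriv A x).inverse (evalMap A x))

/-- `(A, x₀)`, `x₀ = (l₀, v₀)`, is an approximate solution of the eigenvalue problem `(A, x)`,
`x = (l, v)`: the Newton iterates of `x₀` are all defined and converge immediately quadratically
to `x`. -/
def IsApproxSolution {𝕜 : Type*} [RCLike 𝕜] {n : ℕ} (A : Mat 𝕜 n) (x₀ x : 𝕜 × Vec 𝕜 n) : Prop :=
  (∀ k : ℕ, NewtonDefined A ((newtonMap A)^[k] x₀)) ∧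
  ∀ k : ℕ, 1 ≤ k →
    tripleDist A ((newtonMap A)^[k] x₀).1 ((newtonMap A)^[k] x₀).2 A x.1 x.2 ≤
      (1 / 2 : ℝ) ^ (2 ^ k - 1) * tripleDist A x₀.1 x₀.2 A x.1 x.2

/-! ### Normalized representatives and predictor-corrector sequences -/

/-- Multiplication by `c` turns the representative `A` of a path in `ℙ(𝕜^{n×n})` into an absolutely
continuous one, `Â = c A`, with `‖Â‖ = 1` and `⟨Â', Â⟩ = 0`. Up to a constant factor of modulus one,
there is only one such representative. -/
structure IsNormalizing {𝕜 : Type*} [RCLike 𝕜] {n : ℕ} (A : ℝ → Mat 𝕜 n) (c : ℝ → 𝕜) : Prop where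
  absCont_c : IsAbsCont c
  absCont : IsAbsCont fun t => c t • A t
  norm_eq_one : ∀ t ∈ Icc (0 : ℝ) 1, ‖c t • A t‖ = 1
  horizontal : ∀ᵐ t ∂(volume.restrict (Icc (0 : ℝ) 1)),
    inner 𝕜 (c t • A t) (deriv (fun s => c s • A s) t) = 0

/-- The mesh `0 = t₀ < ⋯ < t_K = 1` and the pairs `x_k = (l_k, v_k)`, `0 ≤ k ≤ K`, form a
predictor-corrector sequence for the path of matrices `A`. -/
structure IsPredictorCorrector {𝕜 : Type*} [RCLike 𝕜] {n : ℕ} (A : ℝ → Mat 𝕜 n) (K : ℕ)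
    (t : ℕ → ℝ) (x : ℕ → 𝕜 × Vec 𝕜 n) : Prop where
  mesh_zero : t 0 = 0
  mesh_last : t K = 1
  mesh_lt : ∀ k < K, t k < t (k + 1)
  newton_defined : ∀ k < K, NewtonDefined (A (t (k + 1))) (x k)
  newton_step : ∀ k < K, x (k + 1) = newtonMap (A (t (k + 1))) (x k)

end EigenHomotopy

end

noncomputable section

namespace EigenHomotopy

/-! ### Calculus of absolutely continuous paths -/

section AbsCont

open Filter Topology

variable {E : Type*} [NormedAddCommGroup E]

/-! The proof follows the quantity m = 1/μ along the path. For ‖A‖ = 1 it equals min(1, σ), where σ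
is the smallest singular value of the compression of λI − A to vᗮ (`IsWellPosed.compressionBound`,
`CompressionBound.condNumber_le`). It is Lipschitz in A, λ and the gap, i.e. the sine of the angle
between the eigenlines (`CompressionBound.perturb`, `inv_condNumber_sub_le`).

Since F_A is bilinear up to a linear term, one Newton step turns the eigenvalue error e and the gap
g into errors of order e·g/m (`newton_error`). Hence the ball of radius 0.05m about an eigenpair is
sent into the ball of radius 0.02m, and every point of the latter is an approximate solution
(`IsNear.newton`, `IsNear.isApproxSolution`).

Both A and v have horizontal representatives of norm one (`exists_normalizing`). For these the
displacement of A, λ and v is at most a constant times the length D of the path, and so is the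
variation of m. On a piece of condition length at most 1/100 this forces D to be a small multiple of
m (`length_le_of_condLength_le`), so the 0.02m ball at the start of the piece lies in the 0.05m ball
at its end (`IsNear.transport`), and Newton's method brings the point back to 0.02m. Cutting the
path into pieces of equal condition length (`exists_mesh`) gives at most 100ℓ + 1 steps. All
constants are independent of n because the Frobenius norm dominates the operator norm. -/

theorem intervalIntegrable_of_mem {p : ℝ → E} (hp : IntegrableOn p (Icc (0 : ℝ) 1)) {s t : ℝ}
    (hs : s ∈ Icc (0 : ℝ) 1) (ht : t ∈ Icc (0 : ℝ) 1) : IntervalIntegrable p volume s t := by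
  rw [intervalIntegrable_iff]
  refine hp.mono_set (uIoc_subset_uIcc.trans ?_)
  rw [← uIcc_of_le zero_le_one] at hs ht ⊢
  exact uIcc_subset_uIcc hs ht

theorem integrableOn_smul_of_continuousOn {𝕜 : Type*} [NormedField 𝕜] [NormedSpace 𝕜 E]
    {f : ℝ → 𝕜} {g : ℝ → E}
    (hf : ContinuousOn f (Icc (0 : ℝ) 1)) (hg : IntegrableOn g (Icc (0 : ℝ) 1)) :
    IntegrableOn (fun t ↦ f t • g t) (Icc (0 : ℝ) 1) := by
  obtain ⟨C, hC⟩ := isCompact_Icc.exists_bound_of_continuousOn hf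
  refine Integrable.mono' (hg.norm.const_mul C)
    ((hf.aestronglyMeasurable_of_isCompact isCompact_Icc measurableSet_Icc).smul
      hg.aestronglyMeasurable) ?_
  filter_upwards [ae_restrict_mem measurableSet_Icc] with t ht
  rw [norm_smul]
  gcongr
  exact hC t ht

theorem integrableOn_smul_continuousOn {𝕜 : Type*} [NormedField 𝕜] [NormedSpace 𝕜 E]
    {f : ℝ → 𝕜} {g : ℝ → E}
    (hf : IntegrableOn f (Icc (0 : ℝ) 1)) (hg : ContinuousOn g (Icc (0 : ℝ) 1)) :
    IntegrableOn (fun t ↦ f t • g t) (Icc (0 : ℝ) 1) := by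
  obtain ⟨C, hC⟩ := isCompact_Icc.exists_bound_of_continuousOn hg
  refine Integrable.mono' (hf.norm.mul_const C)
    (hf.aestronglyMeasurable.smul
      (hg.aestronglyMeasurable_of_isCompact isCompact_Icc measurableSet_Icc)) ?_
  filter_upwards [ae_restrict_mem measurableSet_Icc] with t ht
  rw [norm_smul]
  gcongr
  exact hC t ht

variable [NormedSpace ℝ E]

/-- The increments of `g` dominate those of `f`, so the sums in the ε–δ definition are squeezed. All
passages to the ε–δ notion below go through this comparison, except for products. -/
theorem absolutelyContinuousOnInterval_of_dist_le {X Y : Type*} [PseudoMetricSpace X]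
    [PseudoMetricSpace Y] {f : ℝ → X} {g : ℝ → Y} {a b C : ℝ}
    (hg : AbsolutelyContinuousOnInterval g a b)
    (h : ∀ s ∈ uIcc a b, ∀ t ∈ uIcc a b, dist (f s) (f t) ≤ C * dist (g s) (g t)) :
    AbsolutelyContinuousOnInterval f a b := by
  have hC : Tendsto (fun E : ℕ × (ℕ → ℝ × ℝ) ↦
      C * ∑ i ∈ Finset.range E.1, dist (g (E.2 i).1) (g (E.2 i).2))
      (AbsolutelyContinuousOnInterval.totalLengthFilter ⊓
        𝓟 (AbsolutelyContinuousOnInterval.disjWithin a b)) (𝓝 0) := by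
    simpa using Tendsto.const_mul C hg
  refine squeeze_zero' (Eventually.of_forall fun E ↦ Finset.sum_nonneg fun _ _ ↦ dist_nonneg)
    ?_ hC
  filter_upwards [mem_inf_of_right (mem_principal_self _)] with E hE
  rw [Finset.mul_sum]
  exact Finset.sum_le_sum fun i hi ↦ h _ (hE.1 i hi).1 _ (hE.1 i hi).2

theorem absolutelyContinuousOnInterval_integral {p : ℝ → E} {a b : ℝ}
    (hp : IntervalIntegrable p volume a b) :
    AbsolutelyContinuousOnInterval (fun t ↦ ∫ s in a..t, p s) a b := by
  refine absolutelyContinuousOnInterval_of_dist_le (C := 1)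
    (hp.norm.absolutelyContinuousOnInterval_intervalIntegral (c := a) left_mem_uIcc) ?_
  intro s hs t ht
  have hps : IntervalIntegrable p volume a s :=
    hp.mono_set (uIcc_subset_uIcc_left hs)
  have hpt : IntervalIntegrable p volume a t :=
    hp.mono_set (uIcc_subset_uIcc_left ht)
  rw [dist_comm, dist_comm (∫ v in a..s, ‖p v‖), dist_eq_norm, dist_eq_norm,
    intervalIntegral.integral_interval_sub_left hpt hps,
    intervalIntegral.integral_interval_sub_left hpt.norm hps.norm, one_mul]
  exact intervalIntegral.norm_integral_le_abs_integral_norm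

theorem zero_mem_Icc : (0 : ℝ) ∈ Icc (0 : ℝ) 1 := left_mem_Icc.2 zero_le_one

theorem one_mem_Icc : (1 : ℝ) ∈ Icc (0 : ℝ) 1 := right_mem_Icc.2 zero_le_one

theorem IsAbsCont.absolutelyContinuous {f : ℝ → E} (hf : IsAbsCont f) :
    AbsolutelyContinuousOnInterval f 0 1 := by
  obtain ⟨-, hi, hF⟩ := hf
  have h := absolutelyContinuousOnInterval_integral
    (intervalIntegrable_of_mem hi zero_mem_Icc one_mem_Icc)
  refine absolutelyContinuousOnInterval_of_dist_le (C := 1) h ?_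
  intro s hs t ht
  rw [uIcc_of_le zero_le_one] at hs ht
  rw [hF s hs, hF t ht, dist_add_left, one_mul]

theorem IsAbsCont.continuousOn {f : ℝ → E} (hf : IsAbsCont f) :
    ContinuousOn f (Icc (0 : ℝ) 1) := by
  have := hf.absolutelyContinuous.continuousOn
  rwa [uIcc_of_le zero_le_one] at this

/-- The difference between `f` and the integral of `p` is absolutely continuous with derivative zero
almost everywhere, hence constant. -/
theorem isAbsCont_of_absolutelyContinuous [CompleteSpace E] {f p : ℝ → E}
    (hf : AbsolutelyContinuousOnInterval f 0 1) (hp : IntegrableOn p (Icc (0 : ℝ) 1))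
    (hd : ∀ᵐ t ∂(volume.restrict (Icc (0 : ℝ) 1)), HasDerivAt f (p t) t) : IsAbsCont f := by
  have hdp : deriv f =ᵐ[volume.restrict (Icc (0 : ℝ) 1)] p := by
    filter_upwards [hd] with t ht using ht.deriv
  refine ⟨hd.mono fun t ht ↦ ht.differentiableAt, hp.congr hdp.symm, ?_⟩
  have hpi := intervalIntegrable_of_mem hp zero_mem_Icc one_mem_Icc
  have hg := hf.fun_sub (absolutelyContinuousOnInterval_integral hpi)
  obtain ⟨C, hC⟩ := hg.const_of_ae_hasDerivAt_zero (by
    rw [ae_restrict_iff' measurableSet_Icc] at hd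
    filter_upwards [hd, hpi.ae_hasDerivAt_integral] with x h1 h2 h3
    have h4 := (h1 (by rwa [uIcc_of_le zero_le_one] at h3)).sub (h2 h3 0 left_mem_uIcc)
    rwa [sub_self] at h4)
  rw [uIcc_of_le zero_le_one] at hC
  intro t ht
  have h0 := hC 0 zero_mem_Icc
  have h1 := hC t ht
  rw [intervalIntegral.integral_same, sub_zero] at h0
  have h2 : ∫ s in (0 : ℝ)..t, deriv f s = ∫ s in (0 : ℝ)..t, p s := by
    rw [intervalIntegral.integral_of_le ht.1, intervalIntegral.integral_of_le ht.1]
    exact integral_congr_ae (ae_restrict_of_ae_restrict_of_subset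
      (Ioc_subset_Icc_self.trans (Icc_subset_Icc_right ht.2)) hdp)
  rw [h2, h0, ← h1]
  abel

theorem IsAbsCont.sub_eq_integral {f : ℝ → E} (hf : IsAbsCont f) {s t : ℝ}
    (hs : s ∈ Icc (0 : ℝ) 1) (ht : t ∈ Icc (0 : ℝ) 1) :
    f t - f s = ∫ r in s..t, deriv f r := by
  rw [hf.2.2 s hs, hf.2.2 t ht, add_sub_add_left_eq_sub,
    intervalIntegral.integral_interval_sub_left
      (intervalIntegrable_of_mem hf.2.1 zero_mem_Icc ht)
      (intervalIntegrable_of_mem hf.2.1 zero_mem_Icc hs)]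

theorem IsAbsCont.ae_hasDerivAt {f : ℝ → E} (hf : IsAbsCont f) :
    ∀ᵐ t ∂(volume.restrict (Icc (0 : ℝ) 1)), HasDerivAt f (deriv f t) t :=
  hf.1.mono fun _ ht ↦ ht.hasDerivAt

variable {𝕜 : Type*} [RCLike 𝕜]

theorem IsAbsCont.smul [CompleteSpace E] [NormedSpace 𝕜 E] [IsScalarTower ℝ 𝕜 E]
    {c : ℝ → 𝕜} {f : ℝ → E} (hc : IsAbsCont c) (hf : IsAbsCont f) :
    IsAbsCont fun t ↦ c t • f t := by
  refine isAbsCont_of_absolutelyContinuous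
    (p := fun t ↦ c t • deriv f t + deriv c t • f t)
    (hc.absolutelyContinuous.fun_smul hf.absolutelyContinuous)
    ((integrableOn_smul_of_continuousOn hc.continuousOn hf.2.1).add
      (integrableOn_smul_continuousOn hc.2.1 hf.continuousOn)) ?_
  filter_upwards [hc.ae_hasDerivAt, hf.ae_hasDerivAt] with t h1 h2 using h1.smul h2

theorem IsAbsCont.const_add_integral [CompleteSpace E] {p : ℝ → E} (a : E)
    (hp : IntegrableOn p (Icc (0 : ℝ) 1)) :
    IsAbsCont (fun t ↦ a + ∫ s in (0 : ℝ)..t, p s) ∧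
      ∀ᵐ t ∂(volume.restrict (Icc (0 : ℝ) 1)),
        HasDerivAt (fun t ↦ a + ∫ s in (0 : ℝ)..t, p s) (p t) t := by
  have hpi := intervalIntegrable_of_mem hp zero_mem_Icc one_mem_Icc
  have hd : ∀ᵐ t ∂(volume.restrict (Icc (0 : ℝ) 1)),
        HasDerivAt (fun t ↦ a + ∫ s in (0 : ℝ)..t, p s) (p t) t := by
    rw [ae_restrict_iff' measurableSet_Icc]
    filter_upwards [hpi.ae_hasDerivAt_integral] with x h2 h3
    rw [← uIcc_of_le (zero_le_one' ℝ)] at h3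
    exact (h2 h3 0 left_mem_uIcc).const_add a
  refine ⟨isAbsCont_of_absolutelyContinuous ?_ hp hd, hd⟩
  exact absolutelyContinuousOnInterval_of_dist_le (C := 1)
    (absolutelyContinuousOnInterval_integral hpi) fun s _ t _ ↦ by rw [dist_add_left, one_mul]

theorem hasDerivAt_exp_comp {g : ℝ → 𝕜} {g' : 𝕜} {t : ℝ} (hg : HasDerivAt g g' t) :
    HasDerivAt (fun s ↦ NormedSpace.exp (g s)) (NormedSpace.exp (g t) * g') t := by
  have h := (_root_.hasDerivAt_exp (𝕂 := 𝕜) (x := g t)).scomp t hg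
  simpa [mul_comm, Function.comp_def] using h

theorem IsAbsCont.exp {g : ℝ → 𝕜} (hg : IsAbsCont g) :
    IsAbsCont fun t ↦ NormedSpace.exp (g t) := by
  have hcont : ContinuousOn (fun t ↦ NormedSpace.exp (g t)) (Icc (0 : ℝ) 1) :=
    (NormedSpace.exp_continuous (𝔸 := 𝕜)).comp_continuousOn hg.continuousOn
  -- The exponential is Lipschitz on the compact image of `g`, though not globally.
  have hlip : ∃ K, LipschitzOnWith K (NormedSpace.exp : 𝕜 → 𝕜) (g '' Icc (0 : ℝ) 1) := by
    refine LocallyLipschitzOn.exists_lipschitzOnWith_of_compact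
      (isCompact_Icc.image_of_continuousOn hg.continuousOn) ?_
    have : ContDiff 𝕜 1 (NormedSpace.exp : 𝕜 → 𝕜) := 
      contDiff_iff_contDiffAt.2 fun x ↦ (NormedSpace.exp_analytic x).contDiffAt
    exact this.locallyLipschitz.locallyLipschitzOn
  obtain ⟨K, hK⟩ := hlip
  refine isAbsCont_of_absolutelyContinuous
    (absolutelyContinuousOnInterval_of_dist_le (C := K) hg.absolutelyContinuous ?_)
    (integrableOn_smul_of_continuousOn hcont hg.2.1)
    (hg.ae_hasDerivAt.mono fun t ht ↦ hasDerivAt_exp_comp ht)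
  intro s hs t ht
  rw [uIcc_of_le zero_le_one] at hs ht
  exact hK.dist_le_mul _ (mem_image_of_mem g hs) _ (mem_image_of_mem g ht)

end AbsCont

/-! ### Horizontal representatives of norm one. -/

section Normalizing

variable {𝕜 E : Type*} [RCLike 𝕜] [NormedAddCommGroup E] [InnerProductSpace 𝕜 E]
  [NormedSpace ℝ E]

/-- The derivative of ‖g‖² is 2 Re⟨g, g'⟩, which vanishes almost everywhere. -/
theorem norm_eq_of_inner_deriv_eq_zero {g : ℝ → E} (hg : IsAbsCont g)
    (h : ∀ᵐ t ∂(volume.restrict (Icc (0 : ℝ) 1)), inner 𝕜 (g t) (deriv g t) = 0) :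
    ∀ t ∈ Icc (0 : ℝ) 1, ‖g t‖ = ‖g 0‖ := by
  have hn : AbsolutelyContinuousOnInterval (fun t ↦ ‖g t‖) 0 1 :=
    absolutelyContinuousOnInterval_of_dist_le (C := 1) hg.absolutelyContinuous
      fun s _ t _ ↦ by
        rw [one_mul, dist_eq_norm (g s), Real.dist_eq]
        exact abs_norm_sub_norm_le _ _
  obtain ⟨C, hC⟩ := (hn.fun_mul hn).const_of_ae_hasDerivAt_zero (by
    have h1 := hg.ae_hasDerivAt
    rw [ae_restrict_iff' measurableSet_Icc] at h h1
    filter_upwards [h, h1] with t ht ht1 ht2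
    rw [uIcc_of_le zero_le_one] at ht2
    have hd := (ht1 ht2).inner 𝕜 (ht1 ht2)
    rw [ht ht2, inner_eq_zero_symm.1 (ht ht2), add_zero] at hd
    have hd' := RCLike.reCLM.hasFDerivAt.comp_hasDerivAt t hd
    simp only [map_zero] at hd'
    refine hd'.congr_of_eventuallyEq (Filter.Eventually.of_forall fun s ↦ ?_)
    simp [← sq])
  rw [uIcc_of_le zero_le_one] at hC
  intro t ht
  have h2 := (hC t ht).trans (hC 0 zero_mem_Icc).symm
  rw [← sq, ← sq] at h2
  exact (sq_eq_sq₀ (norm_nonneg _) (norm_nonneg _)).1 h2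

variable [IsScalarTower ℝ 𝕜 E] [CompleteSpace E]

/-- A nonvanishing absolutely continuous path has a horizontal representative of norm one. -/
theorem exists_normalizing {f : ℝ → E} (hf : IsAbsCont f) (h0 : ∀ t ∈ Icc (0 : ℝ) 1, f t ≠ 0) :
    ∃ c : ℝ → 𝕜, (∀ t, c t ≠ 0) ∧ IsAbsCont c ∧ IsAbsCont (fun t ↦ c t • f t) ∧
      (∀ t ∈ Icc (0 : ℝ) 1, ‖c t • f t‖ = 1) ∧
      ∀ᵐ t ∂(volume.restrict (Icc (0 : ℝ) 1)),
        inner 𝕜 (c t • f t) (deriv (fun s ↦ c s • f s) t) = 0 := by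
  -- With c = exp(g) and g' = q one has (cf)' = c(f' + qf); this `q` makes it orthogonal to f. The
  -- initial value log ‖f(0)‖⁻¹ of g gives norm one at time 0, and horizontality preserves the norm.
  set q : ℝ → 𝕜 := fun t ↦ ((‖f t‖ ^ 2)⁻¹ : ℝ) • -inner 𝕜 (f t) (deriv f t) with hq
  have hqi : IntegrableOn q (Icc (0 : ℝ) 1) := by
    refine integrableOn_smul_of_continuousOn ?_ ?_
    · refine (hf.continuousOn.norm.pow 2).inv₀ fun t ht ↦ ?_
      exact pow_ne_zero _ (norm_ne_zero_iff.2 (h0 t ht))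
    · obtain ⟨C, hC⟩ := isCompact_Icc.exists_bound_of_continuousOn hf.continuousOn
      refine Integrable.mono' (hf.2.1.norm.const_mul C)
        ((hf.continuousOn.aestronglyMeasurable_of_isCompact isCompact_Icc measurableSet_Icc).inner
          hf.2.1.aestronglyMeasurable).neg ?_
      filter_upwards [ae_restrict_mem measurableSet_Icc] with t ht
      rw [norm_neg]
      exact (norm_inner_le_norm _ _).trans
        (mul_le_mul_of_nonneg_right (hC t ht) (norm_nonneg _))
  obtain ⟨hg, hgd⟩ := IsAbsCont.const_add_integral (Real.log ‖f 0‖⁻¹ : 𝕜) hqi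
  set g : ℝ → 𝕜 := fun t ↦ (Real.log ‖f 0‖⁻¹ : 𝕜) + ∫ s in (0 : ℝ)..t, q s with hgdef
  have hc := hg.exp
  have hcf := hc.smul hf
  have horth : ∀ᵐ t ∂(volume.restrict (Icc (0 : ℝ) 1)),
      inner 𝕜 (NormedSpace.exp (g t) • f t)
        (deriv (fun s ↦ NormedSpace.exp (g s) • f s) t) = 0 := by
    filter_upwards [hgd, hf.ae_hasDerivAt, ae_restrict_mem measurableSet_Icc] with t h1 h2 h3
    have hne : (‖f t‖ : 𝕜) ≠ 0 := by
      simpa using h0 t h3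
    rw [((hasDerivAt_exp_comp h1).fun_smul h2).deriv, inner_add_right, inner_smul_left,
      inner_smul_left, inner_smul_right, inner_smul_right, inner_self_eq_norm_sq_to_K, hq]
    simp only [RCLike.real_smul_eq_coe_mul]
    push_cast
    field_simp
    ring
  refine ⟨_, fun t ↦ ?_, hc, hcf, fun t ht ↦ ?_, horth⟩
  · exact (NormedSpace.isUnit_exp (g t)).ne_zero
  · rw [norm_eq_of_inner_deriv_eq_zero hcf horth t ht]
    have hpos : 0 < ‖f 0‖ := norm_pos_iff.2 (h0 0 zero_mem_Icc)
    have : g 0 = ((Real.log ‖f 0‖⁻¹ : ℝ) : 𝕜) := by simp [hgdef]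
    have h1 : NormedSpace.exp (g 0) = ((‖f 0‖⁻¹ : ℝ) : 𝕜) := by
      rw [this, ← RCLike.algebraMap_eq_ofReal, ← NormedSpace.algebraMap_exp_comm,
        ← Real.exp_eq_exp_ℝ, Real.exp_log (inv_pos.2 hpos)]
    rw [h1, norm_smul, RCLike.norm_ofReal, abs_of_pos (inv_pos.2 hpos),
      inv_mul_cancel₀ hpos.ne']

end Normalizing

/-! ### The gap between two lines -/

section Gap

variable {𝕜 E : Type*} [RCLike 𝕜] [NormedAddCommGroup E] [InnerProductSpace 𝕜 E]

theorem starProjection_orthogonal_singleton (v w : E) :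
    (𝕜 ∙ v)ᗮ.starProjection w = w - (inner 𝕜 v w / ((‖v‖ ^ 2 : ℝ) : 𝕜)) • v := by
  rw [Submodule.starProjection_orthogonal_val, Submodule.starProjection_singleton]

theorem norm_starProjection_orthogonal_le (v w : E) :
    ‖(𝕜 ∙ v)ᗮ.starProjection w‖ ≤ ‖w‖ :=
  Submodule.norm_starProjection_apply_le _ _

theorem starProjection_orthogonal_of_inner_eq_zero {v w : E} (h : inner 𝕜 v w = 0) :
    (𝕜 ∙ v)ᗮ.starProjection w = w :=
  Submodule.starProjection_eq_self_iff.2 (Submodule.mem_orthogonal_singleton_iff_inner_right.2 h)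

theorem starProjection_orthogonal_self (v : E) : (𝕜 ∙ v)ᗮ.starProjection v = 0 :=
  Submodule.starProjection_orthogonalComplement_singleton_eq_zero v

theorem inner_starProjection_orthogonal (v w : E) :
    inner 𝕜 v ((𝕜 ∙ v)ᗮ.starProjection w) = 0 :=
  Submodule.mem_orthogonal_singleton_iff_inner_right.1 (Submodule.starProjection_apply_mem _ w)

/-- Among the differences `w - a v`, the smallest is the projection of `w` to `vᗮ`. -/
theorem norm_starProjection_orthogonal_le_norm_sub (v w : E) (a : 𝕜) :
    ‖(𝕜 ∙ v)ᗮ.starProjection w‖ ≤ ‖w - a • v‖ := by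
  have h : (𝕜 ∙ v)ᗮ.starProjection (w - a • v) = (𝕜 ∙ v)ᗮ.starProjection w := by
    rw [map_sub, map_smul, starProjection_orthogonal_self, smul_zero, sub_zero]
  rw [← h]
  exact norm_starProjection_orthogonal_le _ _

theorem starProjection_orthogonal_smul_left {c : 𝕜} (hc : c ≠ 0) (v w : E) :
    (𝕜 ∙ (c • v))ᗮ.starProjection w = (𝕜 ∙ v)ᗮ.starProjection w := by
  simp only [Submodule.span_singleton_smul_eq hc.isUnit]

theorem norm_sq_starProjection_orthogonal {v : E} (hv : v ≠ 0) (w : E) :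
    ‖(𝕜 ∙ v)ᗮ.starProjection w‖ ^ 2 = ‖w‖ ^ 2 - (‖inner 𝕜 v w‖ / ‖v‖) ^ 2 := by
  have h := Submodule.norm_sq_eq_add_norm_sq_starProjection w (𝕜 ∙ v)
  rw [Submodule.starProjection_singleton, norm_smul, norm_div, RCLike.norm_ofReal,
    abs_of_nonneg (sq_nonneg _)] at h
  have hv' := norm_ne_zero_iff.2 hv
  have h2 : ‖inner 𝕜 v w‖ / ‖v‖ ^ 2 * ‖v‖ = ‖inner 𝕜 v w‖ / ‖v‖ := by
    field_simp
  rw [h2] at h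
  linarith

/-- The sine of the angle between the lines spanned by `v` and `w`. -/
def gap (𝕜 : Type*) {E : Type*} [RCLike 𝕜] [NormedAddCommGroup E] [InnerProductSpace 𝕜 E]
    (v w : E) : ℝ :=
  Real.sin (projDist (𝕜 := 𝕜) v w)

theorem projDist_comm (v w : E) : projDist (𝕜 := 𝕜) v w = projDist (𝕜 := 𝕜) w v := by
  rw [projDist, projDist, norm_inner_symm, mul_comm ‖v‖]

theorem gap_comm (v w : E) : gap 𝕜 v w = gap 𝕜 w v := by
  rw [gap, gap, projDist_comm]

theorem projDist_nonneg (v w : E) : 0 ≤ projDist (𝕜 := 𝕜) v w :=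
  Real.arccos_nonneg _

theorem projDist_le_pi_div_two (v w : E) : projDist (𝕜 := 𝕜) v w ≤ Real.pi / 2 := by
  rw [projDist, Real.arccos_le_pi_div_two]
  positivity

theorem gap_nonneg (v w : E) : 0 ≤ gap 𝕜 v w :=
  Real.sin_nonneg_of_nonneg_of_le_pi (projDist_nonneg _ _)
    ((projDist_le_pi_div_two _ _).trans (by linarith [Real.pi_pos]))

theorem gap_le_projDist (v w : E) : gap 𝕜 v w ≤ projDist (𝕜 := 𝕜) v w :=
  Real.sin_le (projDist_nonneg _ _)

/-- Jordan's inequality sin θ ≥ 2θ/π on [0, π/2], and π/2 < 1.58. -/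
theorem projDist_le_gap (v w : E) : projDist (𝕜 := 𝕜) v w ≤ 1.58 * gap 𝕜 v w := by
  have h := Real.mul_le_sin (projDist_nonneg (𝕜 := 𝕜) v w) (projDist_le_pi_div_two v w)
  have hp := Real.pi_pos
  have h2 := Real.pi_lt_d2
  rw [div_mul_eq_mul_div, div_le_iff₀ hp] at h
  have : gap 𝕜 v w * Real.pi ≤ gap 𝕜 v w * 3.15 :=
    mul_le_mul_of_nonneg_left h2.le (gap_nonneg _ _)
  have h3 := gap_nonneg (𝕜 := 𝕜) v w
  rw [gap] at this h3 ⊢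
  linarith

theorem gap_mul_norm {v w : E} (hv : v ≠ 0) (hw : w ≠ 0) :
    gap 𝕜 v w * ‖w‖ = ‖(𝕜 ∙ v)ᗮ.starProjection w‖ := by
  have hv' := norm_pos_iff.2 hv
  have hw' := norm_pos_iff.2 hw
  rw [gap, projDist, Real.sin_arccos, ← Real.sqrt_sq (norm_nonneg w), ← Real.sqrt_mul',
    ← Real.sqrt_sq (norm_nonneg ((𝕜 ∙ v)ᗮ.starProjection w)), norm_sq_starProjection_orthogonal hv]
  · congr 1
    rw [Real.sqrt_sq (norm_nonneg w)]
    field_simp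
  · positivity

theorem gap_le_of_norm_sub_le {v w : E} (hv : v ≠ 0) (hw : w ≠ 0) (a : 𝕜) :
    gap 𝕜 v w * ‖w‖ ≤ ‖w - a • v‖ :=
  (gap_mul_norm hv hw).trans_le (norm_starProjection_orthogonal_le_norm_sub v w a)

theorem gap_self {v : E} (hv : v ≠ 0) : gap 𝕜 v v = 0 := by
  have h := gap_mul_norm (𝕜 := 𝕜) hv hv
  rw [starProjection_orthogonal_self, norm_zero] at h
  exact (mul_eq_zero.1 h).resolve_right (norm_ne_zero_iff.2 hv)

theorem gap_smul_right {c : 𝕜} (hc : c ≠ 0) (v w : E) : gap 𝕜 v (c • w) = gap 𝕜 v w := by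
  rw [gap, gap, projDist, projDist, inner_smul_right, norm_mul, norm_smul]
  congr 2
  have := norm_ne_zero_iff.2 hc
  rw [mul_left_comm, mul_div_mul_left _ _ this]

/-- The projection to the line of `v` contracts `v'ᗮ` by the gap. -/
theorem norm_inner_le_gap {v v' w : E} (hv : v ≠ 0) (hv' : v' ≠ 0) (h : inner 𝕜 v' w = 0) :
    ‖inner 𝕜 v w‖ ≤ gap 𝕜 v v' * ‖v‖ * ‖w‖ := by
  have h1 : inner 𝕜 v w = inner 𝕜 ((𝕜 ∙ v')ᗮ.starProjection v) w := by
    rw [starProjection_orthogonal_singleton, inner_sub_left, inner_smul_left, h, mul_zero,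
      sub_zero]
  rw [h1, gap_comm, gap_mul_norm hv' hv]
  exact norm_inner_le_norm _ _

/-- The component of `y` along `v'` has norm at most ‖y‖, and its projection to vᗮ is shorter by the
factor `gap`; the rest of `y` is its projection to v'ᗮ. -/
theorem norm_starProjection_sub_gap_le {v v' : E} (hv : v ≠ 0) (hv' : v' ≠ 0) (y : E) :
    ‖(𝕜 ∙ v)ᗮ.starProjection y‖ - gap 𝕜 v v' * ‖y‖ ≤ ‖(𝕜 ∙ v')ᗮ.starProjection y‖ := by
  set z := (𝕜 ∙ v')ᗮ.starProjection y with hz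
  have hy : y = (𝕜 ∙ v').starProjection y + z :=
    (Submodule.starProjection_add_starProjection_orthogonal (K := 𝕜 ∙ v') y).symm
  rw [Submodule.starProjection_singleton] at hy
  set b := inner 𝕜 v' y / ((‖v'‖ ^ 2 : ℝ) : 𝕜) with hb
  have h1 : ‖b‖ * ‖v'‖ ≤ ‖y‖ := by
    rw [← norm_smul, hb, ← Submodule.starProjection_singleton]
    exact Submodule.norm_starProjection_apply_le _ _
  have h2 : ‖(𝕜 ∙ v)ᗮ.starProjection y‖ ≤ ‖b‖ * (gap 𝕜 v v' * ‖v'‖) + ‖z‖ := by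
    rw [gap_mul_norm hv hv', ← norm_smul, ← map_smul]
    conv_lhs => rw [hy, map_add]
    exact (norm_add_le _ _).trans (add_le_add_right (norm_starProjection_orthogonal_le _ _) _)
  nlinarith [gap_nonneg (𝕜 := 𝕜) v v']

end Gap

/-! ### Lower bounds for the compression -/

section Compression

variable {𝕜 : Type*} [RCLike 𝕜] {n : ℕ}

/-- The operator of `𝕜ⁿ` with matrix `A`. -/
def matOp (A : Mat 𝕜 n) : Vec 𝕜 n →L[𝕜] Vec 𝕜 n :=
  Matrix.toEuclideanCLM (n := Fin n) (𝕜 := 𝕜) A.toMatrix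

theorem shiftOp_apply (A : Mat 𝕜 n) (l : 𝕜) (w : Vec 𝕜 n) :
    shiftOp A l w = l • w - matOp A w := by
  simp [shiftOp, matOp, map_sub, map_smul]

theorem matOp_sub (A B : Mat 𝕜 n) : matOp (A - B) = matOp A - matOp B := by
  rw [matOp, matOp, matOp, ← map_sub]
  rfl

theorem matOp_smul (c : 𝕜) (A : Mat 𝕜 n) : matOp (c • A) = c • matOp A := by
  rw [matOp, matOp, ← map_smul]
  rfl

theorem norm_matOp_apply_le (A : Mat 𝕜 n) (w : Vec 𝕜 n) : ‖matOp A w‖ ≤ ‖A‖ * ‖w‖ := by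
  refine le_of_sq_le_sq ?_ (by positivity)
  rw [mul_pow, EuclideanSpace.norm_sq_eq, EuclideanSpace.norm_sq_eq A, EuclideanSpace.norm_sq_eq w,
    Fintype.sum_prod_type, Finset.sum_mul]
  refine Finset.sum_le_sum fun i _ ↦ ?_
  have h : (matOp A w) i = ∑ j, A (i, j) * w j := rfl
  rw [h]
  calc ‖∑ j, A (i, j) * w j‖ ^ 2 ≤ (∑ j, ‖A (i, j)‖ * ‖w j‖) ^ 2 := by
        gcongr
        exact (norm_sum_le _ _).trans_eq (by simp)
    _ ≤ _ := Finset.sum_mul_sq_le_sq_mul_sq _ _ _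

theorem shiftOp_smul_mul (c : 𝕜) (A : Mat 𝕜 n) (l : 𝕜) (w : Vec 𝕜 n) :
    shiftOp (c • A) (c * l) w = c • shiftOp A l w := by
  rw [shiftOp_apply, shiftOp_apply, matOp_smul, smul_sub, mul_smul, smul_apply]

theorem norm_shiftOp_sub_le (A A' : Mat 𝕜 n) (l l' : 𝕜) (w : Vec 𝕜 n) :
    ‖shiftOp A l w - shiftOp A' l' w‖ ≤ (‖A - A'‖ + ‖l - l'‖) * ‖w‖ := by
  have h : shiftOp A l w - shiftOp A' l' w = (l - l') • w - matOp (A - A') w := by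
    rw [shiftOp_apply, shiftOp_apply, matOp_sub, sub_smul, sub_apply]
    abel
  rw [h]
  refine (norm_sub_le _ _).trans ?_
  rw [norm_smul]
  linarith [norm_matOp_apply_le (A - A') w]

theorem norm_eigenvalue_le {A : Mat 𝕜 n} {l : 𝕜} {v : Vec 𝕜 n} (hv : v ≠ 0)
    (h : shiftOp A l v = 0) : ‖l‖ ≤ ‖A‖ := by
  rw [shiftOp_apply, sub_eq_zero] at h
  have h1 := norm_matOp_apply_le A v
  rw [← h, norm_smul] at h1
  exact le_of_mul_le_mul_right h1 (norm_pos_iff.2 hv)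

/-- The compression of `l I - A` to `vᗮ` is bounded below by `m`. -/
def CompressionBound (A : Mat 𝕜 n) (l : 𝕜) (v : Vec 𝕜 n) (m : ℝ) : Prop :=
  ∀ w, inner 𝕜 v w = 0 → m * ‖w‖ ≤ ‖(𝕜 ∙ v)ᗮ.starProjection (shiftOp A l w)‖

/-- Moving `v` costs three gaps. Replacing w ∈ v'ᗮ by its projection w' to vᗮ costs one, since `m ≤
1` and the discarded multiple of `v` is killed by `shiftOp A l`. Changing the space onto which one
projects costs two, since ‖(lI − A)w'‖ ≤ 2‖w‖. -/
theorem CompressionBound.perturb {A A' : Mat 𝕜 n} {l l' : 𝕜} {v v' : Vec 𝕜 n} {m : ℝ}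
    (hA : ‖A‖ ≤ 1) (hv : v ≠ 0) (hv' : v' ≠ 0) (hm0 : 0 ≤ m) (hm1 : m ≤ 1)
    (h0 : shiftOp A l v = 0) (h : CompressionBound A l v m) :
    CompressionBound A' l' v' (m - (‖A - A'‖ + ‖l - l'‖ + 3 * gap 𝕜 v v')) := by
  intro w hw
  set g := gap 𝕜 v v'
  have hg : 0 ≤ g := gap_nonneg _ _
  have hl : ‖l‖ ≤ 1 := (norm_eigenvalue_le hv h0).trans hA
  set a := inner 𝕜 v w / ((‖v‖ ^ 2 : ℝ) : 𝕜) with ha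
  set w' := (𝕜 ∙ v)ᗮ.starProjection w with hw'
  have hww : w = a • v + w' := by
    rw [hw', starProjection_orthogonal_singleton]; abel
  have hav : ‖a • v‖ ≤ g * ‖w‖ := by
    have hvp := norm_pos_iff.2 hv
    have h1 := norm_inner_le_gap hv hv' hw
    rw [ha, norm_smul, norm_div, RCLike.norm_ofReal, abs_of_nonneg (sq_nonneg _)]
    have : ‖inner 𝕜 v w‖ / ‖v‖ ^ 2 * ‖v‖ = ‖inner 𝕜 v w‖ / ‖v‖ := by field_simp
    rw [this, div_le_iff₀ hvp]
    linarith
  have hw'1 : ‖w'‖ ≤ ‖w‖ := norm_starProjection_orthogonal_le _ _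
  have hw'2 : ‖w‖ ≤ g * ‖w‖ + ‖w'‖ := by
    calc ‖w‖ = ‖a • v + w'‖ := by rw [← hww]
      _ ≤ _ := (norm_add_le _ _).trans (by linarith)
  have hsw : shiftOp A l w = shiftOp A l w' := by
    conv_lhs => rw [hww, map_add, map_smul, h0, smul_zero, zero_add]
  have hy : ‖shiftOp A l w'‖ ≤ 2 * ‖w‖ := by
    rw [shiftOp_apply]
    refine (norm_sub_le _ _).trans ?_
    rw [norm_smul]
    have := norm_matOp_apply_le A w'
    nlinarith [norm_nonneg w', norm_nonneg l, norm_nonneg A]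
  have h1 := h w' (inner_starProjection_orthogonal _ _)
  have h2 := norm_starProjection_sub_gap_le (𝕜 := 𝕜) hv hv' (shiftOp A l w')
  have h3 : ‖(𝕜 ∙ v')ᗮ.starProjection (shiftOp A l w)‖ -
      ‖(𝕜 ∙ v')ᗮ.starProjection (shiftOp A' l' w)‖ ≤ (‖A - A'‖ + ‖l - l'‖) * ‖w‖ := by
    refine (norm_sub_norm_le _ _).trans ?_
    rw [← map_sub]
    exact (norm_starProjection_orthogonal_le _ _).trans (norm_shiftOp_sub_le _ _ _ _ _)
  rw [hsw] at h3
  have h4 : m * ‖w‖ ≤ m * (g * ‖w‖) + m * ‖w'‖ := by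
    rw [← mul_add]; exact mul_le_mul_of_nonneg_left hw'2 hm0
  have h5 : m * (g * ‖w‖) ≤ g * ‖w‖ := mul_le_of_le_one_left (by positivity) hm1
  have h6 : g * ‖shiftOp A l w'‖ ≤ g * (2 * ‖w‖) := mul_le_mul_of_nonneg_left hy hg
  have h7 : (m - (‖A - A'‖ + ‖l - l'‖ + 3 * g)) * ‖w‖ =
    m * ‖w‖ - (‖A - A'‖ + ‖l - l'‖) * ‖w‖ - g * ‖w‖ - g * (2 * ‖w‖) := by ring
  rw [h7]
  linarith

theorem CompressionBound.mono {A : Mat 𝕜 n} {l : 𝕜} {v : Vec 𝕜 n} {m m' : ℝ}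
    (h : CompressionBound A l v m) (hm : m' ≤ m) : CompressionBound A l v m' :=
  fun w hw ↦ (mul_le_mul_of_nonneg_right hm (norm_nonneg w)).trans (h w hw)

theorem compressionBound_smul_iff {A : Mat 𝕜 n} {l c : 𝕜} {v : Vec 𝕜 n} {m : ℝ} :
    CompressionBound (c • A) (c * l) v m ↔
      ∀ w, inner 𝕜 v w = 0 →
        m * ‖w‖ ≤ ‖c‖ * ‖(𝕜 ∙ v)ᗮ.starProjection (shiftOp A l w)‖ := by
  simp only [CompressionBound, shiftOp_smul_mul, map_smul, norm_smul]

theorem norm_compression_apply (A : Mat 𝕜 n) (l : 𝕜) (v : Vec 𝕜 n) (w : (𝕜 ∙ v)ᗮ) :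
    ‖compression A l v w‖ = ‖(𝕜 ∙ v)ᗮ.starProjection (shiftOp A l w)‖ := rfl

theorem isInvertible_compression {A : Mat 𝕜 n} {l : 𝕜} {v : Vec 𝕜 n}
    (h : Function.Injective (compression A l v)) : (compression A l v).IsInvertible :=
  ⟨(LinearEquiv.ofInjectiveEndo (compression A l v : (𝕜 ∙ v)ᗮ →ₗ[𝕜] (𝕜 ∙ v)ᗮ)
    h).toContinuousLinearEquiv, by ext; rfl⟩

/-- A kernel vector `w` of the compression satisfies (lI − A)w = bv. It then extends to a tangent
vector of the solution variety whose matrix component is a multiple of `A`, hence zero in the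
tangent space of the projective space; injectivity of `inputDeriv` kills it. -/
theorem IsWellPosed.injective_compression {A : Mat 𝕜 n} {l : 𝕜} {v : Vec 𝕜 n}
    (h : IsWellPosed A l v) : Function.Injective (compression A l v) := by
  obtain ⟨hA, hv, h0, hinj, -⟩ := h
  rw [injective_iff_map_eq_zero]
  rintro ⟨w, hw⟩ hw0
  have hw' : inner 𝕜 v w = 0 := Submodule.mem_orthogonal_singleton_iff_inner_right.1 hw
  have h1 : (𝕜 ∙ v)ᗮ.starProjection (shiftOp A l w) = 0 := by
    rw [← norm_eq_zero, ← norm_compression_apply A l v ⟨w, hw⟩, hw0, norm_zero]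
  rw [starProjection_orthogonal_singleton, sub_eq_zero] at h1
  set b := inner 𝕜 v (shiftOp A l w) / ((‖v‖ ^ 2 : ℝ) : 𝕜)
  have hne : ((‖A‖ ^ 2 + ‖l‖ ^ 2 : ℝ) : 𝕜) ≠ 0 := by
    have := norm_pos_iff.2 hA
    exact RCLike.ofReal_ne_zero.2 (by positivity)
  -- The multiple of (A, l) that must be added to (0, −b) to make it orthogonal to (A, l).
  set a : 𝕜 := starRingEnd 𝕜 l * b / ((‖A‖ ^ 2 + ‖l‖ ^ 2 : ℝ) : 𝕜) with ha
  have hmem : (a • A, a * l - b, w) ∈ tangentSpace A l v := by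
    refine ⟨?_, ?_, hw'⟩
    · have h2 : shiftOp (a • A) (a * l - b) v = a • shiftOp A l v - b • v := by
        rw [shiftOp_apply, shiftOp_apply, matOp_smul, smul_apply, sub_smul, mul_smul, smul_sub]
        abel
      simp only
      rw [h2, h0, h1, smul_zero, zero_sub, neg_add_cancel]
    · have h3 : inner 𝕜 (pair A l) (pair (a • A) (a * l - b)) =
          a * ((‖A‖ : 𝕜) ^ 2 + (‖l‖ : 𝕜) ^ 2) - starRingEnd 𝕜 l * b := by
        rw [WithLp.prod_inner_apply]
        simp only [inner_smul_right, inner_self_eq_norm_sq_to_K, RCLike.inner_apply']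
        rw [← RCLike.conj_mul]
        ring
      simp only
      rw [h3, ha]
      push_cast at hne ⊢
      rw [div_mul_cancel₀ _ hne, sub_self]
  have h4 : inputDeriv A l v ⟨_, hmem⟩ = inputDeriv A l v 0 := by
    rw [map_zero]
    apply Subtype.ext
    change (𝕜 ∙ A)ᗮ.starProjection (a • A) = 0
    rw [map_smul, starProjection_orthogonal_self, smul_zero]
  have h5 := hinj h4
  have h6 : w = 0 := congrArg (fun x : tangentSpace A l v ↦ x.1.2.2) h5
  exact Subtype.ext h6

theorem one_le_condNumber (A : Mat 𝕜 n) (l : 𝕜) (v : Vec 𝕜 n) : 1 ≤ condNumber A l v :=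
  le_max_left _ _

theorem condNumber_pos (A : Mat 𝕜 n) (l : 𝕜) (v : Vec 𝕜 n) : 0 < condNumber A l v :=
  zero_lt_one.trans_le (one_le_condNumber A l v)

theorem IsWellPosed.compressionBound {A : Mat 𝕜 n} {l c : 𝕜} {v : Vec 𝕜 n}
    (h : IsWellPosed A l v) (hc : ‖c • A‖ = 1) :
    CompressionBound (c • A) (c * l) v (condNumber A l v)⁻¹ := by
  rw [compressionBound_smul_iff]
  intro w hw
  have hinv := isInvertible_compression h.injective_compression
  have hw' := Submodule.mem_orthogonal_singleton_iff_inner_right.2 hw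
  rw [inv_mul_le_iff₀ (condNumber_pos A l v), ← norm_compression_apply A l v ⟨w, hw'⟩]
  have h1 : ‖w‖ ≤ ‖(compression A l v).inverse‖ * ‖compression A l v ⟨w, hw'⟩‖ := by
    have := (compression A l v).inverse.le_opNorm (compression A l v ⟨w, hw'⟩)
    rwa [hinv.inverse_apply_self] at this
  rw [norm_smul] at hc
  calc ‖w‖ = ‖c‖ * ‖A‖ * ‖w‖ := by rw [hc, one_mul]
    _ ≤ ‖c‖ * ‖A‖ * (‖(compression A l v).inverse‖ * ‖compression A l v ⟨w, hw'⟩‖) := by gcongr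
    _ = (‖A‖ * ‖(compression A l v).inverse‖) * (‖c‖ * ‖compression A l v ⟨w, hw'⟩‖) := by ring
    _ ≤ _ := by gcongr; exact le_max_right _ _

theorem CompressionBound.condNumber_le {A : Mat 𝕜 n} {l c : 𝕜} {v : Vec 𝕜 n} {m : ℝ}
    (h : CompressionBound (c • A) (c * l) v m) (hc : ‖c • A‖ = 1) (hm0 : 0 < m) (hm1 : m ≤ 1) :
    condNumber A l v ≤ m⁻¹ := by
  rw [compressionBound_smul_iff] at h
  have hinj : Function.Injective (compression A l v) := by
    rw [injective_iff_map_eq_zero]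
    rintro ⟨w, hw⟩ hw0
    have h1 := h w (Submodule.mem_orthogonal_singleton_iff_inner_right.1 hw)
    rw [← norm_compression_apply A l v ⟨w, hw⟩, hw0, norm_zero, mul_zero] at h1
    have : ‖w‖ ≤ 0 := by
      by_contra hcon
      exact absurd h1 (not_le.2 (mul_pos hm0 (not_le.1 hcon)))
    exact Subtype.ext (norm_le_zero_iff.1 this)
  have hinv := isInvertible_compression hinj
  refine max_le ((one_le_inv₀ hm0).2 hm1) ?_
  have hA : 0 < ‖A‖ := by
    rw [norm_pos_iff]; rintro rfl; simp at hc
  rw [norm_smul] at hc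
  rw [← le_div_iff₀' hA]
  refine ContinuousLinearMap.opNorm_le_bound _ (by positivity) fun y ↦ ?_
  have h1 := h _ (Submodule.mem_orthogonal_singleton_iff_inner_right.1
    ((compression A l v).inverse y).2)
  rw [← norm_compression_apply A l v ((compression A l v).inverse y),
    hinv.self_apply_inverse] at h1
  rw [div_mul_eq_mul_div, le_div_iff₀ hA, le_inv_mul_iff₀ hm0]
  calc m * (‖(compression A l v).inverse y‖ * ‖A‖)
      = m * ‖((compression A l v).inverse y : Vec 𝕜 n)‖ * ‖A‖ := by rw [← mul_assoc]; rfl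
    _ ≤ ‖c‖ * ‖y‖ * ‖A‖ := by gcongr
    _ = ‖y‖ := by rw [mul_right_comm, hc, one_mul]

end Compression

/-! ### Convergence of Newton's method -/

section Newton

variable {𝕜 : Type*} [RCLike 𝕜] {n : ℕ}

theorem fderiv_evalMap (A : Mat 𝕜 n) (x y : 𝕜 × Vec 𝕜 n) :
    fderiv 𝕜 (evalMap A) x y = y.1 • x.2 + shiftOp A x.1 y.2 := by
  have h : evalMap A = fun x : 𝕜 × Vec 𝕜 n ↦ x.1 • x.2 - matOp A x.2 := by
    funext x
    rw [evalMap, shiftOp_apply]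
  have h1 : HasFDerivAt (fun x : 𝕜 × Vec 𝕜 n ↦ x.1 • x.2 - matOp A x.2) _ x :=
    (hasFDerivAt_fst.smul hasFDerivAt_snd).sub ((matOp A).hasFDerivAt.comp x hasFDerivAt_snd)
  rw [h, h1.fderiv, shiftOp_apply]
  simp
  abel

theorem newtonDeriv_apply (A : Mat 𝕜 n) (x : 𝕜 × Vec 𝕜 n) (y : 𝕜 × (𝕜 ∙ x.2)ᗮ) :
    newtonDeriv A x y = y.1 • x.2 + shiftOp A x.1 y.2 :=
  fderiv_evalMap A x (y.1, y.2)

/-- If b·v + (lI − A)w = 0 with w ∈ vᗮ, projecting to vᗮ gives w = 0 and then b = 0; the dimensions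
of source and target agree. -/
theorem CompressionBound.newtonDefined {A : Mat 𝕜 n} {x : 𝕜 × Vec 𝕜 n} {m : ℝ}
    (h : CompressionBound A x.1 x.2 m) (hm : 0 < m) (hx : x.2 ≠ 0) : NewtonDefined A x := by
  refine ⟨hx, ?_⟩
  have hinj : Function.Injective (newtonDeriv A x) := by
    rw [injective_iff_map_eq_zero]
    rintro ⟨b, w, hw⟩ h0
    rw [newtonDeriv_apply] at h0
    simp only at h0
    have h1 := h w (Submodule.mem_orthogonal_singleton_iff_inner_right.1 hw)
    have h2 := congrArg (𝕜 ∙ x.2)ᗮ.starProjection h0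
    rw [map_add, map_smul, starProjection_orthogonal_self, smul_zero, zero_add, map_zero] at h2
    rw [h2, norm_zero] at h1
    have hw0 : w = 0 := by
      by_contra hcon
      exact absurd h1 (not_le.2 (mul_pos hm (norm_pos_iff.2 hcon)))
    subst hw0
    rw [map_zero, add_zero, smul_eq_zero] at h0
    exact Prod.ext (h0.resolve_right hx) rfl
  have hfin : Module.finrank 𝕜 (𝕜 × (𝕜 ∙ x.2)ᗮ) = Module.finrank 𝕜 (Vec 𝕜 n) := by
    rw [Module.finrank_prod, Module.finrank_self, ← finrank_span_singleton (K := 𝕜) hx]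
    exact (𝕜 ∙ x.2).finrank_add_finrank_orthogonal
  exact ⟨(LinearEquiv.ofInjectiveOfFinrankEq
    (newtonDeriv A x : (𝕜 × (𝕜 ∙ x.2)ᗮ) →ₗ[𝕜] Vec 𝕜 n) hinj hfin).toContinuousLinearEquiv,
    by ext <;> rfl⟩

theorem NewtonDefined.exists_step {A : Mat 𝕜 n} {x : 𝕜 × Vec 𝕜 n} (h : NewtonDefined A x) :
    ∃ (b : 𝕜) (w : Vec 𝕜 n), inner 𝕜 x.2 w = 0 ∧
      b • x.2 + shiftOp A x.1 w = shiftOp A x.1 x.2 ∧ newtonMap A x = (x.1 - b, x.2 - w) := by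
  set y := (newtonDeriv A x).inverse (evalMap A x) with hy
  refine ⟨y.1, y.2, Submodule.mem_orthogonal_singleton_iff_inner_right.1 y.2.2, ?_, rfl⟩
  rw [← newtonDeriv_apply A x y, hy, h.2.self_apply_inverse]
  rfl

/-- The error of a Newton step is at most the product of the errors in the eigenvalue and in the
eigenvector, up to the condition. -/
theorem newton_error {A : Mat 𝕜 n} {l : 𝕜} {v : Vec 𝕜 n} {x : 𝕜 × Vec 𝕜 n} {m : ℝ}
    (hA : ‖A‖ ≤ 1) (hv : v ≠ 0) (h0 : shiftOp A l v = 0) (hx : x.2 ≠ 0)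
    (h : CompressionBound A x.1 x.2 m) (hm : 0 < m) (hg : gap 𝕜 x.2 v < 1) :
    (newtonMap A x).2 ≠ 0 ∧
    m * (1 - gap 𝕜 x.2 v) * ‖(newtonMap A x).1 - l‖ ≤ ‖x.1 - l‖ * gap 𝕜 x.2 v ∧
    m * (1 - gap 𝕜 x.2 v) * gap 𝕜 (newtonMap A x).2 v ≤ ‖x.1 - l‖ * gap 𝕜 x.2 v := by
  obtain ⟨b, w, hw, hbw, hN⟩ := (h.newtonDefined hm hx).exists_step
  obtain ⟨l₀, v₀⟩ := x
  simp only at hx h hg hw hbw hN ⊢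
  rw [hN]
  simp only
  set g := gap 𝕜 v₀ v with hgdef
  have hg0 : 0 ≤ g := gap_nonneg _ _
  have hv₀ := norm_pos_iff.2 hx
  have hinner : inner 𝕜 v₀ v ≠ 0 := by
    intro hcon
    have h1 := gap_mul_norm (𝕜 := 𝕜) hx hv
    rw [starProjection_orthogonal_of_inner_eq_zero hcon] at h1
    have : 0 < ‖v‖ := norm_pos_iff.2 hv
    nlinarith
  -- The eigenvector is rescaled so that its component along `v₀` is `v₀` itself. Both `u`, its
  -- distance vector from `v₀`, and `z`, the error after the step, then lie in v₀ᗮ.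
  set c : 𝕜 := (‖v₀‖ : 𝕜) ^ 2 / inner 𝕜 v₀ v with hc
  have hc0 : c ≠ 0 := by
    refine div_ne_zero (pow_ne_zero _ ?_) hinner
    exact RCLike.ofReal_ne_zero.2 hv₀.ne'
  set v' := c • v with hv'
  have hv'0 : v' ≠ 0 := smul_ne_zero hc0 hv
  have hs : shiftOp A l v' = 0 := by rw [hv', map_smul, h0, smul_zero]
  have hg' : gap 𝕜 v₀ v' = g := gap_smul_right hc0 _ _
  have hin : inner 𝕜 v₀ v' = (‖v₀‖ : 𝕜) ^ 2 := by
    rw [hv', inner_smul_right, hc, div_mul_cancel₀ _ hinner]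
  set u := v' - v₀ with hu
  have hu0 : inner 𝕜 v₀ u = 0 := by
    rw [hu, inner_sub_right, hin, inner_self_eq_norm_sq_to_K, sub_self]
  have hun : ‖u‖ = g * ‖v'‖ := by
    rw [← hg', gap_mul_norm hx hv'0, show v' = u + v₀ by rw [hu]; abel, map_add,
      starProjection_orthogonal_self, add_zero, starProjection_orthogonal_of_inner_eq_zero hu0]
  have hv'1 : ‖v'‖ ≤ ‖v₀‖ + ‖u‖ := by
    rw [show v' = v₀ + u by rw [hu]; abel]; exact norm_add_le _ _
  have hv'2 : ‖v₀‖ ≤ ‖v'‖ := by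
    have h1 := norm_inner_le_norm (𝕜 := 𝕜) v₀ v'
    rw [hin, norm_pow, RCLike.norm_ofReal, abs_of_pos hv₀, sq] at h1
    exact le_of_mul_le_mul_left h1 hv₀
  have hu1 : ‖u‖ * (1 - g) ≤ g * ‖v₀‖ := by nlinarith
  set z := v₀ - w - v' with hz
  have hz0 : inner 𝕜 v₀ z = 0 := by
    rw [hz, inner_sub_right, inner_sub_right, hw, hin, inner_self_eq_norm_sq_to_K]; simp
  -- The Newton equation minus the eigenvalue equation: the right side is the product of the two
  -- errors. Its projection to v₀ᗮ bounds `z`, and its component along `v₀` bounds the new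
  -- eigenvalue error by `z`.
  have key : (l₀ - b - l) • v₀ + shiftOp A l₀ z = (l - l₀) • u := by
    have h1 : shiftOp A l₀ v' = (l₀ - l) • v' := by
      rw [shiftOp_apply, sub_eq_zero] at hs
      rw [shiftOp_apply, ← hs, sub_smul]
    rw [hz, map_sub, map_sub, h1, ← hbw, hu, sub_smul, sub_smul, sub_smul, sub_smul, smul_sub,
      smul_sub]
    abel
  have hz1 : m * ‖z‖ ≤ ‖l₀ - l‖ * ‖u‖ := by
    have h1 := congrArg (𝕜 ∙ v₀)ᗮ.starProjection key
    rw [map_add, map_smul, starProjection_orthogonal_self, smul_zero, zero_add, map_smul,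
      starProjection_orthogonal_of_inner_eq_zero hu0] at h1
    have h2 := h z hz0
    rwa [h1, norm_smul, norm_sub_rev l l₀] at h2
  have hr : ‖l₀ - b - l‖ * ‖v₀‖ ≤ ‖z‖ := by
    have h1 := congrArg (inner 𝕜 v₀) key
    rw [shiftOp_apply, inner_add_right, inner_sub_right, inner_smul_right, inner_smul_right,
      inner_smul_right, hz0, hu0, mul_zero, mul_zero, zero_sub, add_neg_eq_zero,
      inner_self_eq_norm_sq_to_K] at h1
    have h2 := norm_inner_le_norm (𝕜 := 𝕜) v₀ (matOp A z)
    rw [← h1, norm_mul, norm_pow, RCLike.norm_ofReal, abs_of_pos hv₀] at h2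
    have h3 : ‖matOp A z‖ ≤ ‖z‖ :=
      (norm_matOp_apply_le A z).trans (mul_le_of_le_one_left (norm_nonneg _) hA)
    have h4 : ‖v₀‖ * (‖l₀ - b - l‖ * ‖v₀‖) ≤ ‖v₀‖ * ‖z‖ := by nlinarith
    exact le_of_mul_le_mul_left h4 hv₀
  have hne : v₀ - w ≠ 0 := by
    intro hcon
    have h1 : inner 𝕜 v₀ (v₀ - w) = (0 : 𝕜) := by rw [hcon, inner_zero_right]
    rw [inner_sub_right, hw, sub_zero, inner_self_eq_zero] at h1
    exact hx h1
  have hgz : gap 𝕜 (v₀ - w) v * ‖v₀‖ ≤ ‖z‖ := by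
    have h1 := gap_le_of_norm_sub_le (𝕜 := 𝕜) hne hv'0 1
    rw [one_smul, norm_sub_rev, ← hz, hv', gap_smul_right hc0, ← hv'] at h1
    exact (mul_le_mul_of_nonneg_left hv'2 (gap_nonneg _ _)).trans h1
  have main : ∀ r : ℝ, r * ‖v₀‖ ≤ ‖z‖ → m * (1 - g) * r ≤ ‖l₀ - l‖ * g := by
    intro r hr
    refine le_of_mul_le_mul_right ?_ hv₀
    calc m * (1 - g) * r * ‖v₀‖ = (1 - g) * (m * (r * ‖v₀‖)) := by ring
      _ ≤ (1 - g) * (m * ‖z‖) := by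
          have : 0 ≤ 1 - g := by linarith
          gcongr
      _ ≤ (1 - g) * (‖l₀ - l‖ * ‖u‖) := by
          have : 0 ≤ 1 - g := by linarith
          gcongr
      _ = ‖l₀ - l‖ * (‖u‖ * (1 - g)) := by ring
      _ ≤ ‖l₀ - l‖ * (g * ‖v₀‖) := by gcongr
      _ = _ := by ring
  exact ⟨hne, main _ hr, main _ hgz⟩

/-- `x` is close to the eigenpair `(l, v)`, at the scale `r`. -/
def IsNear (l : 𝕜) (v : Vec 𝕜 n) (r : ℝ) (x : 𝕜 × Vec 𝕜 n) : Prop :=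
  x.2 ≠ 0 ∧ ‖x.1 - l‖ ≤ r ∧ gap 𝕜 x.2 v ≤ r

theorem IsNear.mono {l : 𝕜} {v : Vec 𝕜 n} {r r' : ℝ} {x : 𝕜 × Vec 𝕜 n} (h : IsNear l v r x)
    (hr : r ≤ r') : IsNear l v r' x :=
  ⟨h.1, h.2.1.trans hr, h.2.2.trans hr⟩

variable {A : Mat 𝕜 n} {l : 𝕜} {v : Vec 𝕜 n} {x : 𝕜 × Vec 𝕜 n} {m : ℝ}

/-- The loss is 0.05m from the eigenvalue and 3 · 0.05m from the gap. -/
theorem IsNear.compressionBound (hA : ‖A‖ ≤ 1) (hv : v ≠ 0) (h0 : shiftOp A l v = 0)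
    (hm0 : 0 < m) (hm1 : m ≤ 1) (h : CompressionBound A l v m) (hx : IsNear l v (0.05 * m) x) :
    CompressionBound A x.1 x.2 (0.8 * m) := by
  have h1 := h.perturb (A' := A) (l' := x.1) (v' := x.2) hA hv hx.1 hm0.le hm1 h0
  refine h1.mono ?_
  have h2 := hx.2.1
  have h3 := hx.2.2
  rw [norm_sub_rev] at h2
  rw [gap_comm] at h3
  rw [sub_self, norm_zero]
  linarith

theorem IsNear.newtonDefined (hA : ‖A‖ ≤ 1) (hv : v ≠ 0) (h0 : shiftOp A l v = 0)
    (hm0 : 0 < m) (hm1 : m ≤ 1) (h : CompressionBound A l v m) (hx : IsNear l v (0.05 * m) x) :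
    NewtonDefined A x :=
  (hx.compressionBound hA hv h0 hm0 hm1 h).newtonDefined (by linarith) hx.1

/-- Here 1.32 exceeds 1/(0.8 · 0.95). -/
theorem IsNear.newton_error (hA : ‖A‖ ≤ 1) (hv : v ≠ 0) (h0 : shiftOp A l v = 0)
    (hm0 : 0 < m) (hm1 : m ≤ 1) (h : CompressionBound A l v m) (hx : IsNear l v (0.05 * m) x) :
    (newtonMap A x).2 ≠ 0 ∧
    m * ‖(newtonMap A x).1 - l‖ ≤ 1.32 * (‖x.1 - l‖ * gap 𝕜 x.2 v) ∧
    m * gap 𝕜 (newtonMap A x).2 v ≤ 1.32 * (‖x.1 - l‖ * gap 𝕜 x.2 v) := by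
  have hg : gap 𝕜 x.2 v ≤ 0.05 := hx.2.2.trans (by linarith)
  obtain ⟨h1, h2, h3⟩ := EigenHomotopy.newton_error hA hv h0 hx.1
    (hx.compressionBound hA hv h0 hm0 hm1 h) (by linarith) (hg.trans_lt (by norm_num))
  have key : ∀ r : ℝ, 0 ≤ r → 0.8 * m * (1 - gap 𝕜 x.2 v) * r ≤ ‖x.1 - l‖ * gap 𝕜 x.2 v →
      m * r ≤ 1.32 * (‖x.1 - l‖ * gap 𝕜 x.2 v) := by
    intro r hr hle
    have h5 : 0.05 * (m * r) ≥ gap 𝕜 x.2 v * (m * r) :=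
      mul_le_mul_of_nonneg_right hg (by positivity)
    nlinarith [mul_nonneg hm0.le hr]
  exact ⟨h1, key _ (norm_nonneg _) h2, key _ (gap_nonneg _ _) h3⟩

theorem IsNear.newton (hA : ‖A‖ ≤ 1) (hv : v ≠ 0) (h0 : shiftOp A l v = 0)
    (hm0 : 0 < m) (hm1 : m ≤ 1) (h : CompressionBound A l v m) (hx : IsNear l v (0.05 * m) x) :
    IsNear l v (0.02 * m) (newtonMap A x) := by
  obtain ⟨h1, h2, h3⟩ := hx.newton_error hA hv h0 hm0 hm1 h
  have h4 : ‖x.1 - l‖ * gap 𝕜 x.2 v ≤ (0.05 * m) * (0.05 * m) :=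
    mul_le_mul hx.2.1 hx.2.2 (gap_nonneg _ _) (by positivity)
  refine ⟨h1, le_of_mul_le_mul_left ?_ hm0, le_of_mul_le_mul_left ?_ hm0⟩ <;>
  nlinarith [mul_pos hm0 hm0]

/-! ### Comparison of the distance of triples with the eigenvalue error and the gap. -/

theorem norm_pair_sq (A : Mat 𝕜 n) (l : 𝕜) : ‖pair A l‖ ^ 2 = ‖A‖ ^ 2 + ‖l‖ ^ 2 :=
  WithLp.prod_norm_sq_eq_of_L2 _

theorem norm_le_norm_pair (A : Mat 𝕜 n) (l : 𝕜) : ‖A‖ ≤ ‖pair A l‖ :=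
  le_of_sq_le_sq (by rw [norm_pair_sq]; linarith [sq_nonneg ‖l‖]) (norm_nonneg _)

theorem norm_snd_le_norm_pair (A : Mat 𝕜 n) (l : 𝕜) : ‖l‖ ≤ ‖pair A l‖ :=
  le_of_sq_le_sq (by rw [norm_pair_sq]; linarith [sq_nonneg ‖A‖]) (norm_nonneg _)

theorem pair_ne_zero (hA : A ≠ 0) (l : 𝕜) : pair A l ≠ 0 := by
  rw [← norm_pos_iff]
  exact (norm_pos_iff.2 hA).trans_le (norm_le_norm_pair A l)

theorem gap_pair_le (hA : ‖A‖ = 1) (l l' : 𝕜) : gap 𝕜 (pair A l') (pair A l) ≤ ‖l' - l‖ := by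
  have hA0 : A ≠ 0 := norm_pos_iff.1 (by rw [hA]; exact one_pos)
  have h := gap_le_of_norm_sub_le (𝕜 := 𝕜) (pair_ne_zero hA0 l') (pair_ne_zero hA0 l) 1
  have h1 : pair A l - (1 : 𝕜) • pair A l' = pair 0 (l - l') := by
    rw [one_smul, ← WithLp.toLp_sub, Prod.mk_sub_mk, sub_self]
  have h2 : ‖pair (0 : Mat 𝕜 n) (l - l')‖ = ‖l' - l‖ := by
    rw [← sq_eq_sq₀ (norm_nonneg _) (norm_nonneg _), norm_pair_sq, norm_sub_rev]; simp
  rw [h1, h2] at h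
  have h3 := norm_le_norm_pair A l
  rw [hA] at h3
  nlinarith [gap_nonneg (𝕜 := 𝕜) (pair A l') (pair A l)]

/-- The residual (1 − a)A, l − al' of the projection controls both |1 − a| and |l − al'|, and ‖(A,
l)‖(1 + 1.1) ≤ 1.42 · 2.1 < 3. -/
theorem norm_sub_le_gap_pair (hA : ‖A‖ = 1) {l l' : 𝕜} (hl : ‖l‖ ≤ 1) (hl' : ‖l'‖ ≤ 1.1) :
    ‖l' - l‖ ≤ 3 * gap 𝕜 (pair A l') (pair A l) := by
  have hA0 : A ≠ 0 := norm_pos_iff.1 (by rw [hA]; exact one_pos)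
  have h := gap_mul_norm (𝕜 := 𝕜) (pair_ne_zero hA0 l') (pair_ne_zero hA0 l)
  rw [starProjection_orthogonal_singleton] at h
  set a := inner 𝕜 (pair A l') (pair A l) / ((‖pair A l'‖ ^ 2 : ℝ) : 𝕜)
  have h1 : pair A l - a • pair A l' = pair ((1 - a) • A) (l - a * l') := by
    rw [← WithLp.toLp_smul, ← WithLp.toLp_sub, Prod.smul_mk, Prod.mk_sub_mk, sub_smul, one_smul,
      smul_eq_mul]
  rw [h1] at h
  have h2 := norm_le_norm_pair ((1 - a) • A) (l - a * l')
  have h3 := norm_snd_le_norm_pair ((1 - a) • A) (l - a * l')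
  rw [norm_smul, hA, mul_one] at h2
  have h4 : ‖pair A l‖ ≤ 1.42 := by
    refine le_of_sq_le_sq ?_ (by norm_num)
    rw [norm_pair_sq, hA]
    nlinarith [norm_nonneg l]
  have h5 : ‖l' - l‖ ≤ ‖l - a * l'‖ + ‖1 - a‖ * ‖l'‖ := by
    rw [← norm_mul, norm_sub_rev]
    refine (norm_sub_le _ _).trans' (le_of_eq ?_)
    congr 1; ring
  have h6 : ‖1 - a‖ * ‖l'‖ ≤ ‖pair ((1 - a) • A) (l - a * l')‖ * 1.1 :=
    mul_le_mul h2 hl' (norm_nonneg _) (norm_nonneg _)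
  have h7 := mul_le_mul_of_nonneg_left h4 (gap_nonneg (𝕜 := 𝕜) (pair A l') (pair A l))
  linarith [gap_nonneg (𝕜 := 𝕜) (pair A l') (pair A l)]

theorem tripleDist_nonneg (A : Mat 𝕜 n) (l : 𝕜) (v : Vec 𝕜 n) (A' : Mat 𝕜 n) (l' : 𝕜)
    (v' : Vec 𝕜 n) : 0 ≤ tripleDist A l v A' l' v' :=
  Real.sqrt_nonneg _

theorem tripleDist_sq (A : Mat 𝕜 n) (l : 𝕜) (v : Vec 𝕜 n) (A' : Mat 𝕜 n) (l' : 𝕜)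
    (v' : Vec 𝕜 n) : tripleDist A l v A' l' v' ^ 2 =
      projDist (𝕜 := 𝕜) (pair A l) (pair A' l') ^ 2 + projDist (𝕜 := 𝕜) v v' ^ 2 :=
  Real.sq_sqrt (by positivity)

theorem tripleDist_le (hA : ‖A‖ = 1) {r : ℝ} (h1 : ‖x.1 - l‖ ≤ r) (h2 : gap 𝕜 x.2 v ≤ r) :
    tripleDist A x.1 x.2 A l v ≤ 2.24 * r := by
  have hr : 0 ≤ r := (norm_nonneg _).trans h1
  refine le_of_sq_le_sq ?_ (by positivity)
  rw [tripleDist_sq]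
  have h3 : projDist (𝕜 := 𝕜) (pair A x.1) (pair A l) ≤ 1.58 * r :=
    (projDist_le_gap _ _).trans (by linarith [gap_pair_le hA l x.1])
  have h4 : projDist (𝕜 := 𝕜) x.2 v ≤ 1.58 * r :=
    (projDist_le_gap _ _).trans (by linarith)
  have h5 := pow_le_pow_left₀ (projDist_nonneg _ _) h3 2
  have h6 := pow_le_pow_left₀ (projDist_nonneg _ _) h4 2
  nlinarith [sq_nonneg r]

theorem IsNear.tripleDist_newton_le (hA : ‖A‖ = 1) (hv : v ≠ 0) (h0 : shiftOp A l v = 0)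
    (hm0 : 0 < m) (hm1 : m ≤ 1) (h : CompressionBound A l v m) (hx : IsNear l v (0.02 * m) x) :
    m * tripleDist A (newtonMap A x).1 (newtonMap A x).2 A l v ≤
      4.5 * tripleDist A x.1 x.2 A l v ^ 2 := by
  obtain ⟨-, h2, h3⟩ := (hx.mono (by linarith)).newton_error hA.le hv h0 hm0 hm1 h
  have hl : ‖l‖ ≤ 1 := (norm_eigenvalue_le hv h0).trans_eq hA
  have hl' : ‖x.1‖ ≤ 1.1 := by
    have h4 := norm_sub_norm_le x.1 l
    have h5 := hx.2.1
    linarith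
  have h4 := norm_sub_le_gap_pair hA hl hl'
  have h5 := gap_le_projDist (𝕜 := 𝕜) (pair A x.1) (pair A l)
  have h6 := gap_le_projDist (𝕜 := 𝕜) x.2 v
  set d₁ := projDist (𝕜 := 𝕜) (pair A x.1) (pair A l) with hd₁
  set d₂ := projDist (𝕜 := 𝕜) x.2 v with hd₂
  have hd1 : 0 ≤ d₁ := projDist_nonneg _ _
  have h7 : ‖x.1 - l‖ * gap 𝕜 x.2 v ≤ 3 * d₁ * d₂ :=
    mul_le_mul (by linarith) h6 (gap_nonneg _ _) (by linarith)
  have h8 := tripleDist_sq A x.1 x.2 A l v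
  rw [← hd₁, ← hd₂] at h8
  have h9 := tripleDist_le (x := newtonMap A x) (l := l) (v := v) hA
    (r := 1.32 * (3 * d₁ * d₂) / m) (by rw [le_div_iff₀ hm0]; linarith)
    (by rw [le_div_iff₀ hm0]; linarith)
  rw [mul_div_assoc', le_div_iff₀ hm0] at h9
  -- 2.24 · 1.32 · 3 · d₁d₂ < 9d₁d₂ ≤ 4.5(d₁² + d₂²).
  nlinarith [sq_nonneg (d₁ - d₂)]

theorem IsNear.iterate (hA : ‖A‖ ≤ 1) (hv : v ≠ 0) (h0 : shiftOp A l v = 0)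
    (hm0 : 0 < m) (hm1 : m ≤ 1) (h : CompressionBound A l v m) (hx : IsNear l v (0.02 * m) x)
    (k : ℕ) : IsNear l v (0.02 * m) ((newtonMap A)^[k] x) := by
  induction k with
  | zero => exact hx
  | succ k ih =>
    rw [Function.iterate_succ_apply']
    exact (ih.mono (by linarith)).newton hA hv h0 hm0 hm1 h

theorem IsNear.isApproxSolution (hA : ‖A‖ = 1) (hv : v ≠ 0) (h0 : shiftOp A l v = 0)
    (hm0 : 0 < m) (hm1 : m ≤ 1) (h : CompressionBound A l v m) (hx : IsNear l v (0.02 * m) x) :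
    IsApproxSolution A x (l, v) := by
  have hit := hx.iterate hA.le hv h0 hm0 hm1 h
  refine ⟨fun k ↦ ((hit k).mono (by linarith)).newtonDefined hA.le hv h0 hm0 hm1 h, ?_⟩
  have hd0 := tripleDist_le hA hx.2.1 hx.2.2
  set d := tripleDist A x.1 x.2 A l v with hd
  have hdn : 0 ≤ d := tripleDist_nonneg _ _ _ _ _ _
  have key : ∀ k : ℕ, tripleDist A ((newtonMap A)^[k] x).1 ((newtonMap A)^[k] x).2 A l v ≤
      (1 / 2 : ℝ) ^ (2 ^ k - 1) * d := by
    intro k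
    induction k with
    | zero => simp [hd]
    | succ k ih =>
      have h1 := (hit k).tripleDist_newton_le hA hv h0 hm0 hm1 h
      rw [← Function.iterate_succ_apply' (newtonMap A)] at h1
      have h2 := pow_le_pow_left₀ (tripleDist_nonneg _ _ _ _ _ _) ih 2
      have hexp : 2 ^ (k + 1) - 1 = (2 ^ k - 1) * 2 + 1 := by
        have : 1 ≤ 2 ^ k := Nat.one_le_two_pow
        omega
      rw [mul_pow, ← pow_mul] at h2
      rw [hexp, pow_succ]
      set p : ℝ := (1 / 2 : ℝ) ^ ((2 ^ k - 1) * 2)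
      have hp : 0 ≤ p := by positivity
      refine le_of_mul_le_mul_left ?_ hm0
      -- The initial distance is at most 2.24 · 0.02m = 0.0448m, and 4.5 · 0.0448 < 1/2 supplies the
      -- extra factor one half in the exponent.
      have h3 : d ^ 2 ≤ 0.0448 * m * d := by nlinarith
      have h4 : p * d ^ 2 ≤ p * (0.0448 * m * d) := mul_le_mul_of_nonneg_left h3 hp
      have h5 : 0 ≤ p * (m * d) := by positivity
      linarith
  exact fun k _ ↦ key k

end Newton

/-! ### Equidistribution of a mesh -/

section Mesh

variable {g : ℝ → ℝ≥0∞}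

theorem setLIntegral_Ioc_add (g : ℝ → ℝ≥0∞) {a b c : ℝ} (hab : a ≤ b) (hbc : b ≤ c) :
    (∫⁻ t in Ioc a b, g t) + ∫⁻ t in Ioc b c, g t = ∫⁻ t in Ioc a c, g t := by
  rw [← lintegral_union measurableSet_Ioc (Ioc_disjoint_Ioc_of_le le_rfl),
    Ioc_union_Ioc_eq_Ioc hab hbc]

theorem setLIntegral_Ioc_ne_top (hg : ∫⁻ t in Icc (0 : ℝ) 1, g t ≠ ⊤) {s t : ℝ}
    (hs : s ∈ Icc (0 : ℝ) 1) (ht : t ∈ Icc (0 : ℝ) 1) : ∫⁻ r in Ioc s t, g r ≠ ⊤ :=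
  ne_top_of_le_ne_top hg
    (lintegral_mono_set (Ioc_subset_Icc_self.trans (Icc_subset_Icc hs.1 ht.2)))

/-- Absolute continuity of the lower integral; measurability of `g` is not needed, here or in the
construction of the mesh. -/
theorem continuousOn_setLIntegral_Ioc (hg : ∫⁻ t in Icc (0 : ℝ) 1, g t ≠ ⊤) :
    ContinuousOn (fun t ↦ (∫⁻ r in Ioc 0 t, g r).toReal) (Icc (0 : ℝ) 1) := by
  rw [Metric.continuousOn_iff]
  have key : ∀ ε > 0, ∃ δ > 0, ∀ s ∈ Icc (0 : ℝ) 1, ∀ t ∈ Icc (0 : ℝ) 1, s ≤ t → t - s < δ →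
      dist (∫⁻ r in Ioc 0 s, g r).toReal (∫⁻ r in Ioc 0 t, g r).toReal < ε := by
    intro ε hε
    obtain ⟨δ, hδ, h⟩ := exists_pos_setLIntegral_lt_of_measure_lt hg
      (ENNReal.ofReal_pos.2 hε).ne'
    obtain ⟨δ', hδ'0, hδ'⟩ : ∃ δ' : ℝ, 0 < δ' ∧ ENNReal.ofReal δ' ≤ δ := by
      obtain ⟨r, hr0, hr⟩ := ENNReal.lt_iff_exists_nnreal_btwn.1 hδ
      exact ⟨r, by exact_mod_cast hr0, by simpa using hr.le⟩
    refine ⟨δ', hδ'0, fun s hs t ht hst hlt ↦ ?_⟩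
    have hsub : Ioc s t ⊆ Icc (0 : ℝ) 1 :=
      Ioc_subset_Icc_self.trans (Icc_subset_Icc hs.1 ht.2)
    have h1 := h (Ioc s t) (by
      rw [Measure.restrict_apply measurableSet_Ioc, inter_eq_self_of_subset_left hsub,
        Real.volume_Ioc]
      exact ((ENNReal.ofReal_lt_ofReal_iff hδ'0).2 hlt).trans_le hδ')
    rw [Measure.restrict_restrict measurableSet_Ioc, inter_eq_self_of_subset_left hsub] at h1
    rw [← setLIntegral_Ioc_add g hs.1 hst, ENNReal.toReal_add
      (setLIntegral_Ioc_ne_top hg zero_mem_Icc hs) (setLIntegral_Ioc_ne_top hg hs ht),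
      Real.dist_eq, sub_add_cancel_left, abs_neg, abs_of_nonneg ENNReal.toReal_nonneg]
    exact (ENNReal.lt_ofReal_iff_toReal_lt (setLIntegral_Ioc_ne_top hg hs ht)).1 h1
  intro t ht ε hε
  obtain ⟨δ, hδ, h⟩ := key ε hε
  refine ⟨δ, hδ, fun s hs hst ↦ ?_⟩
  rw [Real.dist_eq] at hst
  rcases le_total s t with hle | hle
  · exact h s hs t ht hle (by linarith [(abs_lt.1 hst).1])
  · rw [dist_comm]
    exact h t ht s hs hle (by linarith [(abs_lt.1 hst).2])

theorem exists_mesh_of_pos (hg : ∫⁻ t in Icc (0 : ℝ) 1, g t ≠ ⊤)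
    (hpos : 0 < (∫⁻ t in Icc (0 : ℝ) 1, g t).toReal) {K : ℕ} (hK : 0 < K) {ε : ℝ}
    (hle : (∫⁻ t in Icc (0 : ℝ) 1, g t).toReal ≤ ε * K) :
    ∃ t : ℕ → ℝ, t 0 = 0 ∧ t K = 1 ∧ (∀ k < K, t k < t (k + 1)) ∧
      (∀ k, t k ∈ Icc (0 : ℝ) 1) ∧
      ∀ k < K, (∫⁻ r in Ioc (t k) (t (k + 1)), g r).toReal ≤ ε := by
  set ℓ := (∫⁻ t in Icc (0 : ℝ) 1, g t).toReal with hℓ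
  set F : ℝ → ℝ := fun t ↦ (∫⁻ r in Ioc 0 t, g r).toReal with hF
  have hK' : (0 : ℝ) < K := Nat.cast_pos.2 hK
  have hF0 : F 0 = 0 := by simp [hF]
  have hF1 : F 1 = ℓ := by
    rw [hF, hℓ]
    simp only
    rw [Measure.restrict_congr_set Ioc_ae_eq_Icc]
  have hFadd : ∀ s ∈ Icc (0 : ℝ) 1, ∀ t ∈ Icc (0 : ℝ) 1, s ≤ t →
      F t = F s + (∫⁻ r in Ioc s t, g r).toReal := by
    intro s hs t ht hst
    rw [hF]
    simp only
    rw [← setLIntegral_Ioc_add g hs.1 hst, ENNReal.toReal_add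
      (setLIntegral_Ioc_ne_top hg zero_mem_Icc hs) (setLIntegral_Ioc_ne_top hg hs ht)]
  -- The mesh points sit at the levels kℓ/K of `F`. The endpoints are prescribed separately because
  -- `F` may be flat near 0 or 1; beyond `K` the value is a dummy.
  have hex : ∀ k : ℕ, ∃ t ∈ Icc (0 : ℝ) 1, (k = 0 → t = 0) ∧ (k = K → t = 1) ∧
      (k ≤ K → F t = k * ℓ / K) := by
    intro k
    rcases eq_or_ne k 0 with rfl | hk0
    · exact ⟨0, zero_mem_Icc, fun _ ↦ rfl, fun h ↦ absurd h hK.ne, fun _ ↦ by simp [hF0]⟩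
    rcases eq_or_ne k K with rfl | hkK
    · refine ⟨1, one_mem_Icc, fun h ↦ absurd h hk0, fun _ ↦ rfl, fun _ ↦ ?_⟩
      rw [hF1, mul_div_cancel_left₀ _ hK'.ne']
    by_cases hkle : k ≤ K
    · have hk' : (k : ℝ) ≤ K := Nat.cast_le.2 hkle
      have hmem : (k * ℓ / K : ℝ) ∈ Icc (F 0) (F 1) := by
        rw [hF0, hF1]
        refine ⟨by positivity, ?_⟩
        rw [div_le_iff₀ hK', mul_comm]
        gcongr
      obtain ⟨t, ht, hFt⟩ := intermediate_value_Icc zero_le_one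
        (continuousOn_setLIntegral_Ioc hg) hmem
      exact ⟨t, ht, fun h ↦ absurd h hk0, fun h ↦ absurd h hkK, fun _ ↦ hFt⟩
    · exact ⟨0, zero_mem_Icc, fun _ ↦ rfl, fun h ↦ absurd h hkK, fun h ↦ absurd h hkle⟩
  choose t ht ht0 htK htF using hex
  have hlt : ∀ k < K, t k < t (k + 1) := by
    intro k hk
    by_contra hcon
    have h1 := hFadd _ (ht (k + 1)) _ (ht k) (not_lt.1 hcon)
    rw [htF k hk.le, htF (k + 1) hk] at h1
    have h2 : (0 : ℝ) ≤ (∫⁻ r in Ioc (t (k + 1)) (t k), g r).toReal := ENNReal.toReal_nonneg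
    have h3 : ((k + 1 : ℕ) : ℝ) * ℓ / K = k * ℓ / K + ℓ / K := by push_cast; ring
    have h4 : 0 < ℓ / K := by positivity
    linarith
  refine ⟨t, ht0 0 rfl, htK K rfl, hlt, ht, fun k hk ↦ ?_⟩
  have h1 := hFadd _ (ht k) _ (ht (k + 1)) (hlt k hk).le
  rw [htF k hk.le, htF (k + 1) hk] at h1
  have h3 : ((k + 1 : ℕ) : ℝ) * ℓ / K = k * ℓ / K + ℓ / K := by push_cast; ring
  have h4 : ℓ / K ≤ ε := by rwa [div_le_iff₀ hK']
  linarith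

/-- The unit interval can be cut into at most `N ℓ + 1` pieces on each of which the integral,
of total value `ℓ`, is at most `1 / N`. -/
theorem exists_mesh (hg : ∫⁻ t in Icc (0 : ℝ) 1, g t ≠ ⊤) {N : ℝ} (hN : 0 < N) :
    ∃ (K : ℕ) (t : ℕ → ℝ), t 0 = 0 ∧ t K = 1 ∧ (∀ k < K, t k < t (k + 1)) ∧
      (∀ k, t k ∈ Icc (0 : ℝ) 1) ∧
      (∀ k < K, (∫⁻ r in Ioc (t k) (t (k + 1)), g r).toReal ≤ N⁻¹) ∧
      (K : ℝ) ≤ N * (∫⁻ t in Icc (0 : ℝ) 1, g t).toReal + 1 := by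
  rcases (ENNReal.toReal_nonneg (a := ∫⁻ t in Icc (0 : ℝ) 1, g t)).eq_or_lt with h0 | hpos
  · refine ⟨1, fun k ↦ if k = 0 then 0 else 1, by simp, by simp, ?_, ?_, ?_, ?_⟩
    · intro k hk
      obtain rfl : k = 0 := by omega
      simp
    · intro k
      simp only
      split_ifs
      exacts [zero_mem_Icc, one_mem_Icc]
    · intro k hk
      obtain rfl : k = 0 := by omega
      simp only [if_true, zero_add, one_ne_zero, if_false]
      rw [Measure.restrict_congr_set Ioc_ae_eq_Icc, ← h0]
      positivity
    · rw [← h0]; simp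
  · set ℓ := (∫⁻ t in Icc (0 : ℝ) 1, g t).toReal
    have hK : 0 < ⌈N * ℓ⌉₊ := Nat.ceil_pos.2 (by positivity)
    obtain ⟨t, h1, h2, h3, h4, h5⟩ := exists_mesh_of_pos hg hpos hK (ε := N⁻¹) (by
      rw [le_inv_mul_iff₀ hN]
      exact Nat.le_ceil _)
    exact ⟨_, t, h1, h2, h3, h4, h5, (Nat.ceil_lt_add_one (by positivity)).le⟩

end Mesh

/-! ### Variation of the path in terms of its speed -/

section Tangent

variable {𝕜 E : Type*} [RCLike 𝕜] [NormedAddCommGroup E] [InnerProductSpace 𝕜 E]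

theorem tangentNorm_nonneg (x w : E) : 0 ≤ tangentNorm (𝕜 := 𝕜) x w := by
  rw [tangentNorm]; positivity

/-- By the product rule this is the invariance of the speed under a change of representative. -/
theorem tangentNorm_smul {c : 𝕜} (hc : c ≠ 0) (c' : 𝕜) (x w : E) :
    tangentNorm (𝕜 := 𝕜) (c • x) (c • w + c' • x) = tangentNorm (𝕜 := 𝕜) x w := by
  rw [tangentNorm, tangentNorm, starProjection_orthogonal_smul_left hc, map_add, map_smul,
    map_smul, starProjection_orthogonal_self, smul_zero, add_zero, norm_smul, norm_smul,
    mul_div_mul_left _ _ (norm_ne_zero_iff.2 hc)]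

theorem tangentNorm_of_horizontal {x w : E} (hx : ‖x‖ = 1) (h : inner 𝕜 x w = 0) :
    tangentNorm (𝕜 := 𝕜) x w = ‖w‖ := by
  rw [tangentNorm, starProjection_orthogonal_of_inner_eq_zero h, hx, div_one]

variable {n : ℕ}

theorem norm_le_tangentNorm_pair {A B : Mat 𝕜 n} {l b : 𝕜} (hA : ‖A‖ = 1) (hl : ‖l‖ ≤ 1)
    (h : inner 𝕜 A B = 0) :
    ‖B‖ ≤ 1.5 * tangentNorm (𝕜 := 𝕜) (pair A l) (pair B b) ∧
      ‖b‖ ≤ 2 * tangentNorm (𝕜 := 𝕜) (pair A l) (pair B b) := by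
  have hA0 : A ≠ 0 := norm_pos_iff.1 (by rw [hA]; exact one_pos)
  have hp := norm_pos_iff.2 (pair_ne_zero hA0 l)
  have hT : ‖(𝕜 ∙ pair A l)ᗮ.starProjection (pair B b)‖ =
      tangentNorm (𝕜 := 𝕜) (pair A l) (pair B b) * ‖pair A l‖ := by
    rw [tangentNorm, div_mul_cancel₀ _ hp.ne']
  have hT0 := tangentNorm_nonneg (𝕜 := 𝕜) (pair A l) (pair B b)
  set T := tangentNorm (𝕜 := 𝕜) (pair A l) (pair B b)
  rw [starProjection_orthogonal_singleton] at hT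
  set a := inner 𝕜 (pair A l) (pair B b) / ((‖pair A l‖ ^ 2 : ℝ) : 𝕜)
  have h1 : pair B b - a • pair A l = pair (B - a • A) (b - a * l) := by
    rw [← WithLp.toLp_smul, ← WithLp.toLp_sub, Prod.smul_mk, Prod.mk_sub_mk, smul_eq_mul]
  have h2 : ‖B - a • A‖ ^ 2 = ‖B‖ ^ 2 + ‖a‖ ^ 2 := by
    rw [@norm_sub_sq 𝕜, inner_smul_right, inner_eq_zero_symm.1 h, norm_smul, hA]
    simp
  have h3 : ‖B‖ ^ 2 + ‖a‖ ^ 2 + ‖b - a * l‖ ^ 2 ≤ 2 * T ^ 2 := by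
    -- Horizontality makes B and aA orthogonal, and ‖(A, l)‖² ≤ 2. Thus ‖B‖ ≤ √2 T, and |b| ≤ |b −
    -- al| + |a| ≤ √2 · √2 T.
    rw [← h2, ← norm_pair_sq, ← h1, hT, mul_pow, norm_pair_sq, hA]
    have hl2 : ‖l‖ ^ 2 ≤ 1 := pow_le_one₀ (norm_nonneg l) hl
    nlinarith [mul_le_mul_of_nonneg_left hl2 (sq_nonneg T)]
  have h4 : ‖b‖ ≤ ‖b - a * l‖ + ‖a‖ := by
    calc ‖b‖ = ‖(b - a * l) + a * l‖ := by rw [sub_add_cancel]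
      _ ≤ ‖b - a * l‖ + ‖a‖ * ‖l‖ := (norm_add_le _ _).trans_eq (by rw [norm_mul])
      _ ≤ _ := by
        have := mul_le_of_le_one_right (norm_nonneg a) hl
        linarith
  refine ⟨le_of_sq_le_sq ?_ (by positivity), le_of_sq_le_sq ?_ (by positivity)⟩
  · nlinarith [sq_nonneg ‖a‖, sq_nonneg ‖b - a * l‖]
  · nlinarith [sq_nonneg ‖B‖, sq_nonneg (‖b - a * l‖ - ‖a‖), norm_nonneg b]

theorem HasDerivAt.pair {A : ℝ → Mat 𝕜 n} {l : ℝ → 𝕜} {A' : Mat 𝕜 n} {l' : 𝕜} {t : ℝ}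
    (hA : HasDerivAt A A' t) (hl : HasDerivAt l l' t) :
    HasDerivAt (fun s ↦ EigenHomotopy.pair (A s) (l s)) (EigenHomotopy.pair A' l') t :=
  ((WithLp.prodContinuousLinearEquiv 2 ℝ (Mat 𝕜 n) 𝕜).symm :
    (Mat 𝕜 n × 𝕜) →L[ℝ] MatScalar 𝕜 n).hasFDerivAt.comp_hasDerivAt t (hA.prodMk hl)

theorem tangentNorm_pair_le_speed (A : ℝ → Mat 𝕜 n) (l : ℝ → 𝕜) (v : ℝ → Vec 𝕜 n) (t : ℝ) :
    tangentNorm (𝕜 := 𝕜) (pair (A t) (l t)) (deriv (fun s ↦ pair (A s) (l s)) t) ≤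
      speed A l v t :=
  Real.le_sqrt_of_sq_le (le_add_of_nonneg_right (sq_nonneg _))

theorem tangentNorm_le_speed (A : ℝ → Mat 𝕜 n) (l : ℝ → 𝕜) (v : ℝ → Vec 𝕜 n) (t : ℝ) :
    tangentNorm (𝕜 := 𝕜) (v t) (deriv v t) ≤ speed A l v t :=
  Real.le_sqrt_of_sq_le (le_add_of_nonneg_left (sq_nonneg _))

theorem speed_nonneg (A : ℝ → Mat 𝕜 n) (l : ℝ → 𝕜) (v : ℝ → Vec 𝕜 n) (t : ℝ) :
    0 ≤ speed A l v t :=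
  Real.sqrt_nonneg _

end Tangent

/-- The estimate is carried out with lower integrals, so that `p`, later the speed, need not be
measurable. -/
theorem norm_sub_le_of_deriv_le {E : Type*} [NormedAddCommGroup E] [NormedSpace ℝ E]
    {f : ℝ → E} {p : ℝ → ℝ} {C : ℝ} (hf : IsAbsCont f) (hC : 0 ≤ C)
    (h : ∀ᵐ t ∂(volume.restrict (Icc (0 : ℝ) 1)), ‖deriv f t‖ ≤ C * p t) {s t : ℝ}
    (hs : s ∈ Icc (0 : ℝ) 1) (ht : t ∈ Icc (0 : ℝ) 1) (hst : s ≤ t)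
    (hp : ∫⁻ r in Ioc s t, ENNReal.ofReal (p r) ≠ ⊤) :
    ‖f t - f s‖ ≤ C * (∫⁻ r in Ioc s t, ENNReal.ofReal (p r)).toReal := by
  have hsub : Ioc s t ⊆ Icc (0 : ℝ) 1 := Ioc_subset_Icc_self.trans (Icc_subset_Icc hs.1 ht.2)
  have h1 : ‖f t - f s‖ₑ ≤ ENNReal.ofReal C * ∫⁻ r in Ioc s t, ENNReal.ofReal (p r) := by
    rw [hf.sub_eq_integral hs ht, intervalIntegral.integral_of_le hst,
      ← lintegral_const_mul' _ _ ENNReal.ofReal_ne_top]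
    refine (enorm_integral_le_lintegral_enorm _).trans (lintegral_mono_ae ?_)
    filter_upwards [ae_restrict_of_ae_restrict_of_subset hsub h] with r hr
    rw [← ofReal_norm, ← ENNReal.ofReal_mul hC]
    exact ENNReal.ofReal_le_ofReal hr
  have h2 := ENNReal.toReal_mono (ENNReal.mul_ne_top ENNReal.ofReal_ne_top hp) h1
  rwa [toReal_enorm, ENNReal.toReal_mul, ENNReal.toReal_ofReal hC] at h2

/-! ### Predictor-corrector steps along a path -/

section Path

variable {𝕜 : Type*} [RCLike 𝕜] {n : ℕ} {A : ℝ → Mat 𝕜 n} {l : ℝ → 𝕜} {v : ℝ → Vec 𝕜 n}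
  {c d : ℝ → 𝕜} {s t : ℝ}

theorem inv_condNumber_sub_le {A A' : Mat 𝕜 n} {l l' c c' : 𝕜} {v v' : Vec 𝕜 n}
    (h : IsWellPosed A l v) (h' : IsWellPosed A' l' v') (hc : ‖c • A‖ = 1) (hc' : ‖c' • A'‖ = 1) :
    (condNumber A l v)⁻¹ -
      (‖c • A - c' • A'‖ + ‖c * l - c' * l'‖ + 3 * gap 𝕜 v v') ≤ (condNumber A' l' v')⁻¹ := by
  have hm1 : (condNumber A l v)⁻¹ ≤ 1 := inv_le_one_of_one_le₀ (one_le_condNumber A l v)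
  have h1 := (h.compressionBound hc).perturb (A' := c' • A') (l' := c' * l') hc.le h.2.1 h'.2.1
    (inv_pos.2 (condNumber_pos A l v)).le hm1
    (by rw [shiftOp_smul_mul, h.2.2.1, smul_zero])
  have hg := gap_nonneg (𝕜 := 𝕜) v v'
  set m := (condNumber A l v)⁻¹ -
    (‖c • A - c' • A'‖ + ‖c * l - c' * l'‖ + 3 * gap 𝕜 v v') with hm
  -- A nonpositive lower bound is trivial; a positive one bounds the inverse of the compression.
  rcases le_or_gt m 0 with hm0 | hm0
  · exact hm0.trans (inv_pos.2 (condNumber_pos A' l' v')).le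
  · rw [le_inv_comm₀ hm0 (condNumber_pos A' l' v')]
    refine h1.condNumber_le hc' hm0 ?_
    have := norm_nonneg (c • A - c' • A')
    have := norm_nonneg (c * l - c' * l')
    linarith

theorem IsWellPosedPath.deriv_le_speed (hΓ : IsWellPosedPath A l v) (hc0 : ∀ t, c t ≠ 0)
    (hc : IsNormalizing A c) :
    (∀ᵐ t ∂(volume.restrict (Icc (0 : ℝ) 1)),
      ‖deriv (fun s ↦ c s • A s) t‖ ≤ 1.5 * speed A l v t) ∧
    ∀ᵐ t ∂(volume.restrict (Icc (0 : ℝ) 1)),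
      ‖deriv (fun s ↦ c s * l s) t‖ ≤ 2 * speed A l v t := by
  rw [← Filter.eventually_and]
  filter_upwards [hΓ.absCont_A.ae_hasDerivAt, hΓ.absCont_l.ae_hasDerivAt,
    hc.absCont_c.ae_hasDerivAt, hc.horizontal, ae_restrict_mem measurableSet_Icc]
    with t hA hl hct hh ht
  have hwp := hΓ.wellPosed t ht
  have h1 := hct.fun_smul hA
  have h2 : HasDerivAt (fun s ↦ c s * l s) (c t • deriv l t + deriv c t • l t) t :=
    hct.fun_smul hl
  have h3 : ‖c t * l t‖ ≤ 1 := (norm_eigenvalue_le hwp.2.1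
    (by rw [shiftOp_smul_mul, hwp.2.2.1, smul_zero])).trans_eq (hc.norm_eq_one t ht)
  obtain ⟨h4, h5⟩ := norm_le_tangentNorm_pair (b := deriv (fun s ↦ c s * l s) t)
    (hc.norm_eq_one t ht) h3 hh
  have h6 : tangentNorm (𝕜 := 𝕜) (pair (c t • A t) (c t * l t))
      (pair (deriv (fun s ↦ c s • A s) t) (deriv (fun s ↦ c s * l s) t)) ≤ speed A l v t := by
    refine le_trans (le_of_eq ?_) (tangentNorm_pair_le_speed A l v t)
    rw [h1.deriv, h2.deriv, (HasDerivAt.pair hA hl).deriv]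
    exact tangentNorm_smul (hc0 t) (deriv c t) (pair (A t) (l t)) (pair (deriv A t) (deriv l t))
  exact ⟨h4.trans (by linarith), h5.trans (by linarith)⟩

theorem IsWellPosedPath.deriv_smul_le_speed (hΓ : IsWellPosedPath A l v) (hd0 : ∀ t, d t ≠ 0)
    (hd : IsAbsCont d) (hd1 : ∀ t ∈ Icc (0 : ℝ) 1, ‖d t • v t‖ = 1)
    (hdh : ∀ᵐ t ∂(volume.restrict (Icc (0 : ℝ) 1)),
      inner 𝕜 (d t • v t) (deriv (fun s ↦ d s • v s) t) = 0) :
    ∀ᵐ t ∂(volume.restrict (Icc (0 : ℝ) 1)),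
      ‖deriv (fun s ↦ d s • v s) t‖ ≤ 1 * speed A l v t := by
  filter_upwards [hΓ.absCont_v.ae_hasDerivAt, hd.ae_hasDerivAt, hdh,
    ae_restrict_mem measurableSet_Icc] with t hv hdt hh ht
  rw [one_mul, ← tangentNorm_of_horizontal (hd1 t ht) hh, (hdt.fun_smul hv).deriv,
    tangentNorm_smul (hd0 t)]
  exact tangentNorm_le_speed A l v t

theorem setLIntegral_speed_le (A : ℝ → Mat 𝕜 n) (l : ℝ → 𝕜) (v : ℝ → Vec 𝕜 n) (s t : ℝ) :
    ∫⁻ r in Ioc s t, ENNReal.ofReal (speed A l v r) ≤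
      ∫⁻ r in Ioc s t, ENNReal.ofReal (speed A l v r * condNumber (A r) (l r) (v r)) :=
  lintegral_mono fun _ ↦ ENNReal.ofReal_le_ofReal
    (le_mul_of_one_le_right (speed_nonneg _ _ _ _) (one_le_condNumber _ _ _))

/-- The displacement along a path, between two times, of the normalized representatives, is
bounded by the length `D`. -/
structure DisplacementBound (A : ℝ → Mat 𝕜 n) (l : ℝ → 𝕜) (v : ℝ → Vec 𝕜 n) (c d : ℝ → 𝕜)
    (s t D : ℝ) : Prop where
  mat : ‖c s • A s - c t • A t‖ ≤ 1.5 * D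
  scalar : ‖c s * l s - c t * l t‖ ≤ 2 * D
  vec : ‖d s • v s - d t • v t‖ ≤ D

theorem gap_le_norm_sub {v v' : Vec 𝕜 n} {d d' : 𝕜} (hd : d ≠ 0) (hd' : d' ≠ 0)
    (h : ‖d • v‖ = 1) (h' : ‖d' • v'‖ = 1) : gap 𝕜 v v' ≤ ‖d • v - d' • v'‖ := by
  have h1 : d • v ≠ 0 := norm_pos_iff.1 (by rw [h]; exact one_pos)
  have h2 : d' • v' ≠ 0 := norm_pos_iff.1 (by rw [h']; exact one_pos)
  have h3 := gap_le_of_norm_sub_le (𝕜 := 𝕜) h1 h2 1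
  rwa [h', mul_one, one_smul, gap_smul_right hd', gap_comm, gap_smul_right hd, gap_comm,
    norm_sub_rev] at h3

theorem DisplacementBound.inv_condNumber_sub_le {D : ℝ} (hΓ : IsWellPosedPath A l v)
    (hc1 : ∀ t ∈ Icc (0 : ℝ) 1, ‖c t • A t‖ = 1) (hd0 : ∀ t, d t ≠ 0)
    (hd1 : ∀ t ∈ Icc (0 : ℝ) 1, ‖d t • v t‖ = 1) (hs : s ∈ Icc (0 : ℝ) 1)
    (ht : t ∈ Icc (0 : ℝ) 1) (h : DisplacementBound A l v c d s t D) :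
    |(condNumber (A s) (l s) (v s))⁻¹ - (condNumber (A t) (l t) (v t))⁻¹| ≤ 6.5 * D := by
  have hg := gap_le_norm_sub (hd0 s) (hd0 t) (hd1 s hs) (hd1 t ht)
  have h1 := EigenHomotopy.inv_condNumber_sub_le (hΓ.wellPosed s hs) (hΓ.wellPosed t ht)
    (hc1 s hs) (hc1 t ht)
  have h2 := EigenHomotopy.inv_condNumber_sub_le (hΓ.wellPosed t ht) (hΓ.wellPosed s hs)
    (hc1 t ht) (hc1 s hs)
  rw [gap_comm, norm_sub_rev, norm_sub_rev (c t * l t)] at h2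
  have := h.mat
  have := h.scalar
  have := h.vec
  rw [abs_le]
  constructor <;> linarith

/-- On a short piece of the path, measured in the condition metric, the displacement is small in
comparison with the inverse of the condition number. -/
theorem length_le_of_condLength_le {D : ℝ}
    (hfin : ∫⁻ r in Ioc s t,
      ENNReal.ofReal (speed A l v r * condNumber (A r) (l r) (v r)) ≠ ⊤)
    (hle : (∫⁻ r in Ioc s t,
      ENNReal.ofReal (speed A l v r * condNumber (A r) (l r) (v r))).toReal ≤ (100 : ℝ)⁻¹)
    (hD : D = (∫⁻ r in Ioc s t, ENNReal.ofReal (speed A l v r)).toReal)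
    (h : ∀ r ∈ Ioc s t,
      |(condNumber (A s) (l s) (v s))⁻¹ - (condNumber (A r) (l r) (v r))⁻¹| ≤ 6.5 * D) :
    D ≤ 0.0107 * (condNumber (A s) (l s) (v s))⁻¹ := by
  set m := (condNumber (A s) (l s) (v s))⁻¹ with hm
  have hm0 : 0 < m := inv_pos.2 (condNumber_pos _ _ _)
  have hD0 : 0 ≤ D := by rw [hD]; exact ENNReal.toReal_nonneg
  -- On the piece μ ≥ 1/(m + 6.5D), so the condition length is at least D/(m + 6.5D).
  have h1 : ENNReal.ofReal (m + 6.5 * D)⁻¹ * ∫⁻ r in Ioc s t, ENNReal.ofReal (speed A l v r) ≤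
      ∫⁻ r in Ioc s t, ENNReal.ofReal (speed A l v r * condNumber (A r) (l r) (v r)) := by
    rw [← lintegral_const_mul' _ _ ENNReal.ofReal_ne_top]
    refine setLIntegral_mono' measurableSet_Ioc fun r hr ↦ ?_
    rw [← ENNReal.ofReal_mul (by positivity), mul_comm]
    refine ENNReal.ofReal_le_ofReal (mul_le_mul_of_nonneg_left ?_ (speed_nonneg _ _ _ _))
    rw [inv_le_comm₀ (by positivity) (condNumber_pos _ _ _)]
    have := (abs_le.1 (h r hr)).1
    linarith
  have h2 := (ENNReal.toReal_mono hfin h1).trans hle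
  rw [ENNReal.toReal_mul, ENNReal.toReal_ofReal (by positivity), ← hD,
    inv_mul_le_iff₀ (by positivity)] at h2
  norm_num at h2
  -- 100D ≤ m + 6.5D, that is D ≤ m/93.5.
  linarith

theorem gap_le_add_norm_sub {x v v' : Vec 𝕜 n} {d d' : 𝕜} (hx : x ≠ 0) (hd : d ≠ 0)
    (hd' : d' ≠ 0) (h : ‖d • v‖ = 1) (h' : ‖d' • v'‖ = 1) :
    gap 𝕜 x v' ≤ gap 𝕜 x v + ‖d • v - d' • v'‖ := by
  have h1 : d • v ≠ 0 := norm_pos_iff.1 (by rw [h]; exact one_pos)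
  have h2 : d' • v' ≠ 0 := norm_pos_iff.1 (by rw [h']; exact one_pos)
  have h3 := gap_mul_norm (𝕜 := 𝕜) hx h1
  have h4 := gap_mul_norm (𝕜 := 𝕜) hx h2
  rw [h, mul_one, gap_smul_right hd] at h3
  rw [h', mul_one, gap_smul_right hd'] at h4
  rw [h3, h4, norm_sub_rev, ← sub_le_iff_le_add']
  refine (norm_sub_norm_le _ _).trans ?_
  rw [← map_sub]
  exact norm_starProjection_orthogonal_le _ _

variable {𝕜 : Type*} [RCLike 𝕜] {n : ℕ} {A : ℝ → Mat 𝕜 n} {l : ℝ → 𝕜} {v : ℝ → Vec 𝕜 n}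
  {c d : ℝ → 𝕜} {s t : ℝ}

/-- A pair which is close to the eigenpair at time `s` is in the basin of Newton's method for the
eigenpair at time `t`, if the condition length between the two times is small. -/
theorem IsNear.transport (hΓ : IsWellPosedPath A l v) (hc0 : ∀ t, c t ≠ 0)
    (hc : IsNormalizing A c) (hd0 : ∀ t, d t ≠ 0) (hd : IsAbsCont d)
    (hdv : IsAbsCont fun t ↦ d t • v t) (hd1 : ∀ t ∈ Icc (0 : ℝ) 1, ‖d t • v t‖ = 1)
    (hdh : ∀ᵐ t ∂(volume.restrict (Icc (0 : ℝ) 1)),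
      inner 𝕜 (d t • v t) (deriv (fun s ↦ d s • v s) t) = 0)
    (hst : s ≤ t) (hs : s ∈ Icc (0 : ℝ) 1) (ht : t ∈ Icc (0 : ℝ) 1)
    (hfin : ∫⁻ r in Ioc s t,
      ENNReal.ofReal (speed A l v r * condNumber (A r) (l r) (v r)) ≠ ⊤)
    (hle : (∫⁻ r in Ioc s t,
      ENNReal.ofReal (speed A l v r * condNumber (A r) (l r) (v r))).toReal ≤ (100 : ℝ)⁻¹)
    {x : 𝕜 × Vec 𝕜 n}
    (hx : IsNear (c s * l s) (v s) (0.02 * (condNumber (A s) (l s) (v s))⁻¹) x) :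
    IsNear (c t * l t) (v t) (0.05 * (condNumber (A t) (l t) (v t))⁻¹) x := by
  have hspeed := ne_top_of_le_ne_top hfin (setLIntegral_speed_le A l v s t)
  set D := (∫⁻ r in Ioc s t, ENNReal.ofReal (speed A l v r)).toReal with hD
  obtain ⟨hA', hl'⟩ := hΓ.deriv_le_speed hc0 hc
  have hv' := hΓ.deriv_smul_le_speed hd0 hd hd1 hdh
  have hcl : IsAbsCont fun t ↦ c t * l t := hc.absCont_c.smul hΓ.absCont_l
  -- The length `D` of the whole piece bounds the displacement at every intermediate time, so no
  -- continuation argument is needed.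
  have hdisp : ∀ r ∈ Icc s t, DisplacementBound A l v c d s r D := by
    intro r hr
    have hr1 : r ∈ Icc (0 : ℝ) 1 := ⟨hs.1.trans hr.1, hr.2.trans ht.2⟩
    have hmono : ∫⁻ r in Ioc s r, ENNReal.ofReal (speed A l v r) ≤
        ∫⁻ r in Ioc s t, ENNReal.ofReal (speed A l v r) :=
      lintegral_mono_set (Ioc_subset_Ioc_right hr.2)
    have hr2 := ne_top_of_le_ne_top hspeed hmono
    have hr3 := ENNReal.toReal_mono hspeed hmono
    rw [← hD] at hr3
    refine ⟨?_, ?_, ?_⟩ <;> rw [norm_sub_rev]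
    · exact (norm_sub_le_of_deriv_le hc.absCont (by norm_num) hA' hs hr1 hr.1 hr2).trans
        (by linarith)
    · exact (norm_sub_le_of_deriv_le hcl (by norm_num) hl' hs hr1 hr.1 hr2).trans (by linarith)
    · exact (norm_sub_le_of_deriv_le hdv zero_le_one hv' hs hr1 hr.1 hr2).trans (by linarith)
  have hcond : ∀ r ∈ Icc s t,
      |(condNumber (A s) (l s) (v s))⁻¹ - (condNumber (A r) (l r) (v r))⁻¹| ≤ 6.5 * D :=
    fun r hr ↦ (hdisp r hr).inv_condNumber_sub_le hΓ hc.norm_eq_one hd0 hd1 hs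
      ⟨hs.1.trans hr.1, hr.2.trans ht.2⟩
  have hDle := length_le_of_condLength_le hfin hle hD fun r hr ↦ hcond r (Ioc_subset_Icc_self hr)
  have hct := (abs_le.1 (hcond t (right_mem_Icc.2 hst))).2
  have hdt := hdisp t (right_mem_Icc.2 hst)
  have hgap := gap_le_add_norm_sub hx.1 (hd0 s) (hd0 t) (hd1 s hs) (hd1 t ht)
  have h1 := hdt.scalar
  have h2 := hdt.vec
  have h3 := hx.2.1
  have h4 := hx.2.2
  have h5 : ‖x.1 - c t * l t‖ ≤ ‖x.1 - c s * l s‖ + ‖c s * l s - c t * l t‖ :=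
    norm_sub_le_norm_sub_add_norm_sub _ _ _
  have h6 : 0 < (condNumber (A s) (l s) (v s))⁻¹ := inv_pos.2 (condNumber_pos _ _ _)
  -- With m taken at time s, the errors at time t are at most (0.02 + 2 · 0.0107)m = 0.0414m, while
  -- the radius there is at least 0.05(1 − 6.5 · 0.0107)m > 0.046m.
  exact ⟨hx.1, by linarith, by linarith⟩

end Path

end EigenHomotopy

end

open EigenHomotopy in
theorem theorem3 {𝕜 : Type*} [RCLike 𝕜] (n : ℕ) (hn : 2 ≤ n)
    (A : ℝ → Mat 𝕜 n) (l : ℝ → 𝕜) (v : ℝ → Vec 𝕜 n)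
    (hΓ : IsWellPosedPath A l v) (hlen : condLength A l v < ⊤) :
    ∃ c : ℝ → 𝕜, IsNormalizing A c ∧
      ∃ (K : ℕ) (t : ℕ → ℝ) (x : ℕ → 𝕜 × Vec 𝕜 n),
        IsPredictorCorrector (fun s => c s • A s) K t x ∧
        (∀ k ≤ K, IsApproxSolution (c (t k) • A (t k)) (x k)
          (c (t k) * l (t k), v (t k))) ∧
        (K : ℝ) ≤ 100 * (condLength A l v).toReal + 1 := by
  obtain ⟨c, hc0, hcc, hcA, hc1, hch⟩ := exists_normalizing (𝕜 := 𝕜) hΓ.absCont_A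
    fun t ht ↦ (hΓ.wellPosed t ht).1
  -- The normalization of `v` serves only the estimates: the gap does not depend on the
  -- representative.
  obtain ⟨d, hd0, hdd, hdv, hd1, hdh⟩ := exists_normalizing (𝕜 := 𝕜) hΓ.absCont_v
    fun t ht ↦ (hΓ.wellPosed t ht).2.1
  have hc : IsNormalizing A c := ⟨hcc, hcA, hc1, hch⟩
  obtain ⟨K, t, ht0, htK, hlt, ht, hint, hK⟩ := exists_mesh hlen.ne (N := 100) (by norm_num)
  -- The sequence starts at the exact eigenpair at time 0.
  let x : ℕ → 𝕜 × Vec 𝕜 n := fun k ↦ Nat.rec (c (t 0) * l (t 0), v (t 0))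
    (fun k y ↦ newtonMap (c (t (k + 1)) • A (t (k + 1))) y) k
  let m : ℝ → ℝ := fun s ↦ (condNumber (A s) (l s) (v s))⁻¹
  have hm0 : ∀ s, 0 < m s := fun s ↦ inv_pos.2 (condNumber_pos _ _ _)
  have hm1 : ∀ s, m s ≤ 1 := fun s ↦ inv_le_one_of_one_le₀ (one_le_condNumber _ _ _)
  have hwp := fun k ↦ hΓ.wellPosed (t k) (ht k)
  have heig : ∀ k, shiftOp (c (t k) • A (t k)) (c (t k) * l (t k)) (v (t k)) = 0 := fun k ↦ by
    rw [shiftOp_smul_mul, (hwp k).2.2.1, smul_zero]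
  have hbd := fun k ↦ (hwp k).compressionBound (hc1 _ (ht k))
  have hpred : ∀ k < K, IsNear (c (t k) * l (t k)) (v (t k)) (0.02 * m (t k)) (x k) →
      IsNear (c (t (k + 1)) * l (t (k + 1))) (v (t (k + 1))) (0.05 * m (t (k + 1))) (x k) :=
    fun k hk hx ↦ hx.transport hΓ hc0 hc hd0 hdd hdv hd1 hdh (hlt k hk).le (ht k) (ht (k + 1))
      (setLIntegral_Ioc_ne_top hlen.ne (ht k) (ht (k + 1))) (hint k hk)
  have hnear : ∀ k ≤ K, IsNear (c (t k) * l (t k)) (v (t k)) (0.02 * m (t k)) (x k) := by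
    intro k
    induction k with
    | zero =>
      intro _
      have h0 : 0 ≤ 0.02 * m (t 0) := by have := hm0 (t 0); positivity
      refine ⟨(hwp 0).2.1, ?_, ?_⟩
      · simpa [x] using h0
      · exact (gap_self (hwp 0).2.1).trans_le h0
    | succ k ih =>
      intro hk
      exact (hpred k hk (ih (Nat.le_of_succ_le hk))).newton (hc1 _ (ht (k + 1))).le
        (hwp (k + 1)).2.1 (heig (k + 1)) (hm0 _) (hm1 _) (hbd (k + 1))
  refine ⟨c, hc, K, t, x, ⟨ht0, htK, hlt, fun k hk ↦ ?_, fun k _ ↦ rfl⟩, fun k hk ↦ ?_, hK⟩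
  · exact (hpred k hk (hnear k hk.le)).newtonDefined (hc1 _ (ht (k + 1))).le
      (hwp (k + 1)).2.1 (heig (k + 1)) (hm0 _) (hm1 _) (hbd (k + 1))
  · exact (hnear k hk).isApproxSolution (hc1 _ (ht k)) (hwp k).2.1 (heig k) (hm0 _) (hm1 _)
      (hbd k)
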